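/- Let $M$ be an $n$-dimensional $C^\infty$ manifold (Hausdorff, second countable) and $\pi:T^*M\to M$ its cotangent bundle; everything is $C^\infty$. For a symmetric $k$-contravariant tensor field $Q\in S_k(TM)$ let $\tilde Q(\xi)=Q(\xi,\dots,\xi)$ be the corresponding fibrewise homogeneous polynomial of degree $k$ on $T^*M$; write $m(X)=\tilde X$ for a vector field $X$, $s(G)=\tilde G$ for $G\in S_2(TM)$, and $f$ for $f\circ\pi$. Put $X\odot Y=\frac12(X\otimes Y+Y\otimes X)$. A bivector field $w$ has the bracket $\{f,g\}_w=w(df,dg)$ and the map $\sharp$ with $\beta(\sharp\alpha)=w(\alpha,\beta)$; it is a Poisson structure if the bracket satisfies the Jacobi identity. A bivector field $W$ on $T^*M$ with bracket $\{\ ,\ \}$ is graded if $\{\tilde Q,\tilde R\}$ is homogeneous of degree $h+k$ whenever $\tilde Q$, $\tilde R$ are homogeneous of degrees $h$, $k$. A contravariant connection $D$ on $(M,w)$ assigns to a one-form $\alpha$ and a vector field $X$ a vector field $D_\alpha X$, additively in $\alpha$ and in $X$, with $D_{f\alpha}X=fD_\alpha X$ and $D_\alpha(fX)=fD_\alpha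 X+((\sharp\alpha)f)X$. It is flat if $D_\alpha D_\beta X-D_\beta D_\alpha X=D_{[\alpha,\beta]_w}X$, where $[\alpha,\beta]_w=L_{\sharp\alpha}\beta-L_{\sharp\beta}\alpha-d(w(\alpha,\beta))$. It acts on one-forms by $\langle D_\alpha\beta,X\rangle=(\sharp\alpha)\langle\beta,X\rangle-\langle\beta,D_\alpha X\rangle$ and on $Q\in S_k(TM)$ by $(D_\alpha Q)(\beta_1,\dots,\beta_k)=(\sharp\alpha)(Q(\beta_1,\dots,\beta_k))-\sum_iQ(\beta_1,\dots,D_\alpha\beta_i,\dots,\beta_k)$. Below, $\Psi$ denotes a biadditive skew-symmetric operator sending two vector fields to an element of $S_2(TM)$ with $\Psi(X,fY)=f\Psi(X,Y)-(D_{df}X)\odot Y$, and $(D_{df}\Psi)(X,Y)=D_{df}(\Psi(X,Y))-\Psi(D_{df}X,Y)-\Psi(X,D_{df}Y)$. Consider, for a bivector field $W$ on $T^*M$, a bivector field $w$ on $M$, a contravariant connection $D$ on $(M,w)$, such a $\Psi$, and an operator $\Theta:S_2(TM)\times\chi(M)\to S_3(TM)$, the relations $$\{f,g\}=\{f,g\}_w,\quad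 \{m(X),f\}=-m(D_{df}X),\quad \{m(X),m(Y)\}=s(\Psi(X,Y)),\quad \{s(G),m(X)\}=\widetilde{\Theta(G,X)}\tag{R}$$ for all functions $f,g$ and vector fields $X,Y$ on $M$ and all $G\in S_2(TM)$, and the conditions a) $w$ is a Poisson structure on $M$; b) $D$ is flat; c) $D_{df}\Psi=0$ for all $f$; d) $\Theta(\Psi(X,Y),Z)+\Theta(\Psi(Y,Z),X)+\Theta(\Psi(Z,X),Y)=0$ for all vector fields $X,Y,Z$. Then: (i) For every graded Poisson structure $W$ on $T^*M$ there is exactly one quadruple $(w,D,\Psi,\Theta)$ with (R), and it satisfies a)–d). (ii) Conversely, for every bivector field $w$ on $M$, contravariant connection $D$ on $(M,w)$ and operator $\Psi$ as above, there are exactly one bivector field $W$ on $T^*M$ and exactly one operator $\Theta$ with (R). This $W$ is graded, and it is a Poisson structure if and only if a)–d) hold. So graded Poisson structures on $T^*M$ correspond bijectively to such data with a)–d). -/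

import Mathlib

open Bundle Manifold ContDiff Topology

set_option linter.unusedSectionVars false

noncomputable section

namespace GradedPoisson

/-! ### Sections of vector bundles as a module over the smooth functions -/

section SMul

variable {E : Type*} [NormedAddCommGroup E] [NormedSpace ℝ E]
  {H : Type*} [TopologicalSpace H]
  {I : ModelWithCorners ℝ E H} {M : Type*} [TopologicalSpace M] [ChartedSpace H M]
  {F : Type*} [NormedAddCommGroup F] [NormedSpace ℝ F]
  {V : M → Type*} [TopologicalSpace (TotalSpace F V)]
  [∀ x, AddCommGroup (V x)] [∀ x, Module ℝ (V x)] [∀ x : M, TopologicalSpace (V x)]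
  [FiberBundle F V] [VectorBundle ℝ F V]

/-- Pointwise multiplication of a smooth section by a smooth function. -/
instance instSMulSection : SMul C^∞⟮I, M; ℝ⟯ Cₛ^∞⟮I; F, V⟯ where
  smul f X := ⟨fun x => f x • X x, f.contMDiff.smul_section X.contMDiff⟩

@[simp] theorem smul_section_apply (f : C^∞⟮I, M; ℝ⟯) (X : Cₛ^∞⟮I; F, V⟯) (x : M) :
    (f • X) x = f x • X x := rfl

end SMul

section Frames

variable {E : Type*} [NormedAddCommGroup E] [NormedSpace ℝ E] [FiniteDimensional ℝ E]
  {H : Type*} [TopologicalSpace H]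
  {I : ModelWithCorners ℝ E H} {M : Type*} [TopologicalSpace M] [ChartedSpace H M] [T2Space M]
  [IsManifold I ∞ M]
  {F : Type*} [NormedAddCommGroup F] [NormedSpace ℝ F] [FiniteDimensional ℝ F]
  {V : M → Type*} [TopologicalSpace (TotalSpace F V)]
  [∀ x, AddCommGroup (V x)] [∀ x, Module ℝ (V x)] [∀ x : M, TopologicalSpace (V x)]
  [FiberBundle F V] [VectorBundle ℝ F V] [ContMDiffVectorBundle ∞ F V I]

/-- Near every point there is a frame consisting of restrictions of global smooth sections. -/
theorem exists_frame {ι : Type*} [Fintype ι] (b : Module.Basis ι ℝ F) (x₀ : M) :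
    ∃ (ψ : C^∞⟮I, M; ℝ⟯) (s : ι → Cₛ^∞⟮I; F, V⟯), ψ =ᶠ[𝓝 x₀] 1 ∧
      tsupport ψ ⊆ (trivializationAt F V x₀).baseSet ∧
      ∀ y, ∀ v : V y,
        ψ y • v = ∑ i, b.repr (trivializationAt F V x₀ ⟨y, v⟩).2 i • s i y := by
  classical
  set t := trivializationAt F V x₀ with ht
  obtain ⟨ψ, -, hψ⟩ := (SmoothBumpFunction.nhds_basis_tsupport (I := I) x₀).mem_iff.1
    (t.open_baseSet.mem_nhds (FiberBundle.mem_baseSet_trivializationAt F V x₀))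
  refine ⟨⟨ψ, ψ.contMDiff⟩, fun i => ⟨fun y => ψ y • t.localFrame b i y, ?_⟩, ψ.eventuallyEq_one,
    hψ, ?_⟩
  · exact ContMDiffOn.smul_section_of_tsupport (ψ.contMDiff.contMDiffOn) t.open_baseSet hψ
      (t.contMDiffOn_localFrame_baseSet ∞ b i)
  · intro y v
    change ψ y • v = ∑ i, b.repr (t ⟨y, v⟩).2 i • (ψ y • t.localFrame b i y)
    by_cases hy : y ∈ t.baseSet
    · have h := (t.basisAt b hy).sum_repr v
      conv_lhs => rw [← h, Finset.smul_sum]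
      refine Finset.sum_congr rfl fun i _ => ?_
      rw [t.localFrame_apply_of_mem_baseSet b hy, smul_comm]
      simp [Trivialization.basisAt]
    · have : ψ y = 0 := by
        by_contra h
        exact hy (hψ (subset_tsupport _ h))
      simp [this]

/-- Every vector of a smooth vector bundle is the value of a global smooth section. -/
theorem exists_section_eq (x₀ : M) (v : V x₀) : ∃ X : Cₛ^∞⟮I; F, V⟯, X x₀ = v := by
  obtain ⟨ψ, s, hψ, -, hs⟩ := exists_frame (I := I) (V := V) (Module.finBasis ℝ F) x₀
  refine ⟨∑ i, (Module.finBasis ℝ F).repr (trivializationAt F V x₀ ⟨x₀, v⟩).2 i • s i, ?_⟩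
  have h := hs x₀ v
  rw [hψ.eq_of_nhds] at h
  simp only [Pi.one_apply, one_smul] at h
  conv_rhs => rw [h]
  change ContMDiffSection.coeAddHom I F ∞ V _ x₀ = _
  rw [map_sum]
  simp

theorem exists_decomp {ι : Type*} [Fintype ι] (b : Module.Basis ι ℝ F) (x₀ : M) :
    ∃ (ψ : C^∞⟮I, M; ℝ⟯) (s : ι → Cₛ^∞⟮I; F, V⟯), ψ =ᶠ[𝓝 x₀] 1 ∧
      (∀ y, ∀ v : V y,
        ψ y • v = ∑ i, b.repr (trivializationAt F V x₀ ⟨y, v⟩).2 i • s i y) ∧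
      ∀ X : Cₛ^∞⟮I; F, V⟯, ∃ C : ι → C^∞⟮I, M; ℝ⟯,
        (∀ i y, C i y = ψ y * b.repr (trivializationAt F V x₀ ⟨y, X y⟩).2 i) ∧
        (ψ * ψ) • X = ∑ i, C i • s i := by
  obtain ⟨ψ, s, hψ, hsupp, hs⟩ := exists_frame (I := I) (V := V) b x₀
  refine ⟨ψ, s, hψ, hs, fun X => ?_⟩
  set t := trivializationAt F V x₀ with ht
  refine ⟨fun i => ⟨fun y => ψ y * b.repr (t ⟨y, X y⟩).2 i, ?_⟩, fun i y => rfl, ?_⟩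
  · refine contMDiff_of_tsupport fun y hy => ?_
    have hy' : y ∈ t.baseSet := hsupp (tsupport_mul_subset_left hy)
    refine ψ.contMDiff.contMDiffAt.mul ?_
    have h1 : ContMDiffAt I 𝓘(ℝ, F) ∞ (fun x => (t ⟨x, X x⟩).2) y :=
      (t.contMDiffAt_section_iff hy').1 X.contMDiff.contMDiffAt
    exact ((LinearMap.toContinuousLinearMap (b.coord i)).contMDiff.contMDiffAt).comp y h1
  · ext y
    change _ = ContMDiffSection.coeAddHom I F ∞ V _ y
    rw [map_sum, Finset.sum_apply]
    change (ψ y * ψ y) • X y = ∑ i, (ψ y * b.repr (t ⟨y, X y⟩).2 i) • s i y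
    rw [mul_smul, hs y (X y), Finset.smul_sum]
    exact Finset.sum_congr rfl fun i _ => (mul_smul _ _ _).symm

/-- In the decomposition of a section along a frame, a function-linear functional has the expected
pointwise expression. -/
theorem apply_eq_sum {φ : Cₛ^∞⟮I; F, V⟯ → C^∞⟮I, M; ℝ⟯} (hadd : ∀ X Y, φ (X + Y) = φ X + φ Y)
    (hsmul : ∀ (f : C^∞⟮I, M; ℝ⟯) X, φ (f • X) = f * φ X) (x₀ : M) :
    ∃ s : Fin (Module.finrank ℝ F) → Cₛ^∞⟮I; F, V⟯, ∀ᶠ y in 𝓝 x₀, ∀ X : Cₛ^∞⟮I; F, V⟯,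
      φ X y = ∑ i, (Module.finBasis ℝ F).repr (trivializationAt F V x₀ ⟨y, X y⟩).2 i *
        φ (s i) y := by
  obtain ⟨ψ, s, hψ, -, hd⟩ := exists_decomp (I := I) (V := V) (Module.finBasis ℝ F) x₀
  refine ⟨s, hψ.mono fun y (h1 : ψ y = 1) Z => ?_⟩
  let Φ : Cₛ^∞⟮I; F, V⟯ →+ C^∞⟮I, M; ℝ⟯ := AddMonoidHom.mk' φ hadd
  obtain ⟨C, hC, hZ⟩ := hd Z
  have h2 := congrArg (fun W => Φ W y) hZ
  simp only [map_sum] at h2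
  have h3 : ∀ (g : C^∞⟮I, M; ℝ⟯) W, Φ (g • W) = g * φ W := hsmul
  simp only [h3] at h2
  have h4 : ((ψ * ψ) * φ Z) y = φ Z y := by simp [h1]
  rw [h4] at h2
  rw [h2]
  have h5 : ∀ G : Fin (Module.finrank ℝ F) → C^∞⟮I, M; ℝ⟯, (∑ i, G i) y = ∑ i, G i y := fun G =>
    map_sum (ContMDiffMap.evalRingHom (n := ∞) (I := I) (R := ℝ) y) G Finset.univ
  rw [h5]
  simp [hC, h1]

/-- A function-linear functional on sections is tensorial: its value at a point depends only on
the value of the section at that point. -/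
theorem apply_eq_of_eq {φ : Cₛ^∞⟮I; F, V⟯ → C^∞⟮I, M; ℝ⟯} (hadd : ∀ X Y, φ (X + Y) = φ X + φ Y)
    (hsmul : ∀ (f : C^∞⟮I, M; ℝ⟯) X, φ (f • X) = f * φ X) {X Y : Cₛ^∞⟮I; F, V⟯} {x : M}
    (h : X x = Y x) : φ X x = φ Y x := by
  obtain ⟨s, hs⟩ := apply_eq_sum hadd hsmul x
  rw [hs.self_of_nhds X, hs.self_of_nhds Y, h]

end Frames

/-! ### Functions, vector fields, one-forms, the cotangent bundle -/

section Basic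

variable {E : Type*} [NormedAddCommGroup E] [NormedSpace ℝ E]
  {H : Type*} [TopologicalSpace H]
  (I : ModelWithCorners ℝ E H) (M : Type*) [TopologicalSpace M] [ChartedSpace H M]

/-- The algebra of smooth real functions on `M`. -/
abbrev Fn := C^∞⟮I, M; ℝ⟯

variable [IsManifold I ∞ M]

/-- Smooth vector fields on `M`. -/
abbrev VField := Cₛ^∞⟮I; E, (TangentSpace I : M → Type _)⟯

/-- The total space of the cotangent bundle of `M`. -/
abbrev Cotangent := TotalSpace (E →L[ℝ] ℝ) (fun x : M => TangentSpace I x →L[ℝ] ℝ)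

variable (E) in
/-- The model on which the manifold `Cotangent I M` is modelled. -/
abbrev cotModel : ModelWithCorners ℝ (E × (E →L[ℝ] ℝ)) (ModelProd H (E →L[ℝ] ℝ)) :=
  I.prod 𝓘(ℝ, E →L[ℝ] ℝ)

/-- Smooth one-forms on `M`: smooth sections of the cotangent bundle. -/
abbrev OneForm := Cₛ^∞⟮I; E →L[ℝ] ℝ, (fun x : M => TangentSpace I x →L[ℝ] ℝ)⟯

variable {I M}

theorem contMDiff_of_trivial {E' : Type*} [NormedAddCommGroup E'] [NormedSpace ℝ E']
    {H' : Type*} [TopologicalSpace H'] {J : ModelWithCorners ℝ E' H'}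
    {N : Type*} [TopologicalSpace N] [ChartedSpace H' N] {b : N → M} {g : N → ℝ}
    (h : ContMDiff J (I.prod 𝓘(ℝ, ℝ)) ∞
      (fun x => TotalSpace.mk' ℝ (E := fun _ : M => ℝ) (b x) (g x))) :
    ContMDiff J 𝓘(ℝ, ℝ) ∞ g := fun x =>
  (contMDiffAt_totalSpace.1 (h x)).2

/-- The smooth function `⟨α, X⟩ : x ↦ α_x(X_x)`. -/
def pairing (α : OneForm I M) (X : VField I M) : Fn I M where
  val x := α x (X x)
  property := contMDiff_of_trivial (b := fun x : M => x)
    (ContMDiff.clm_bundle_apply (F₂ := ℝ) (E₂ := fun _ : M => ℝ) α.contMDiff X.contMDiff)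

@[simp] theorem pairing_apply (α : OneForm I M) (X : VField I M) (x : M) :
    pairing α X x = α x (X x) := rfl

/-- The differential `df`. -/
def diff (f : Fn I M) : OneForm I M where
  toFun x := mvfderiv I f x
  contMDiff_toFun := by
    intro x
    rw [contMDiffAt_hom_bundle]
    refine ⟨contMDiffAt_id, ?_⟩
    refine (ContMDiffAt.mfderiv_const (f.contMDiff x) (m := ∞) (by simp)).congr_of_eventuallyEq
      (Filter.Eventually.of_forall fun y => ?_)
    ext v
    simp [inTangentCoordinates, ContinuousLinearMap.inCoordinates, mvfderiv]
    rfl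

/-- The derivative `X f` of a function along a vector field. -/
def fieldDeriv (X : VField I M) (f : Fn I M) : Fn I M := pairing (diff f) X

theorem fieldDeriv_apply (X : VField I M) (f : Fn I M) (x : M) :
    fieldDeriv X f x = mvfderiv I f x (X x) := rfl

theorem fieldDeriv_add (X : VField I M) (f g : Fn I M) :
    fieldDeriv X (f + g) = fieldDeriv X f + fieldDeriv X g := by
  ext x
  have hf : MDifferentiableAt I 𝓘(ℝ, ℝ) f x := f.contMDiff.mdifferentiableAt (by simp)
  have hg : MDifferentiableAt I 𝓘(ℝ, ℝ) g x := g.contMDiff.mdifferentiableAt (by simp)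
  have := mvfderiv_add hf hg
  simp [fieldDeriv_apply, this]

theorem fieldDeriv_mul (X : VField I M) (f g : Fn I M) :
    fieldDeriv X (f * g) = f * fieldDeriv X g + g * fieldDeriv X f := by
  ext x
  have hf : MDifferentiableAt I 𝓘(ℝ, ℝ) f x := f.contMDiff.mdifferentiableAt (by simp)
  have hg : MDifferentiableAt I 𝓘(ℝ, ℝ) g x := g.contMDiff.mdifferentiableAt (by simp)
  have := mvfderiv_mul hf hg
  simp [fieldDeriv_apply, this]

/-- The Lie bracket `[X, Y]` of vector fields. -/
def lieBracket [CompleteSpace E] (X Y : VField I M) : VField I M where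
  toFun := VectorField.mlieBracket I X Y
  contMDiff_toFun :=
    haveI : IsManifold I (minSmoothness ℝ 2) M :=
      IsManifold.of_le (n := ∞) (by simpa using (mod_cast le_top : ((2 : ℕ∞) : ℕ∞ω) ≤ ∞))
    haveI : IsManifold I (((⊤ : ℕ∞) : ℕ∞ω) + 1) M := by simpa using ‹IsManifold I ∞ M›
    ContDiff.mlieBracket_vectorField (m := ⊤) (n := ⊤) X.contMDiff Y.contMDiff (by simp)

theorem lieBracket_add [CompleteSpace E] (X Y Z : VField I M) :
    lieBracket X (Y + Z) = lieBracket X Y + lieBracket X Z := by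
  have : IsManifold I 2 M :=
    IsManifold.of_le (n := ∞) (mod_cast le_top : ((2 : ℕ∞) : ℕ∞ω) ≤ ∞)
  ext x
  exact VectorField.mlieBracket_add_right Y.mdifferentiableAt Z.mdifferentiableAt

theorem lieBracket_smul [CompleteSpace E] (X Y : VField I M) (f : Fn I M) :
    lieBracket X (f • Y) = f • lieBracket X Y + fieldDeriv X f • Y := by
  have : IsManifold I 2 M :=
    IsManifold.of_le (n := ∞) (mod_cast le_top : ((2 : ℕ∞) : ℕ∞ω) ≤ ∞)
  ext x
  exact (VectorField.mlieBracket_smul_right (f.contMDiff.mdifferentiableAt (by simp))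
    Y.mdifferentiableAt).trans (add_comm _ _)

theorem pairing_add (α : OneForm I M) (X Y : VField I M) :
    pairing α (X + Y) = pairing α X + pairing α Y := by
  ext x
  exact map_add (α x) _ _

theorem pairing_smul (α : OneForm I M) (f : Fn I M) (X : VField I M) :
    pairing α (f • X) = f * pairing α X := by
  ext x
  exact map_smul (α x) _ _

/-- The function `f ∘ π` on the cotangent bundle. -/
def basic (f : Fn I M) : Fn (cotModel E I) (Cotangent I M) :=
  f.comp ⟨TotalSpace.proj, contMDiff_proj _⟩

/-- The momentum `m(X)`: the vector field `X` seen as a function on the cotangent bundle. -/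
def momentum (X : VField I M) : Fn (cotModel E I) (Cotangent I M) where
  val ξ := ξ.2 (X ξ.1)
  property := contMDiff_of_trivial (b := fun ξ : Cotangent I M => ξ.1)
    (ContMDiff.clm_bundle_apply (F₂ := ℝ) (E₂ := fun _ : M => ℝ) (ϕ := fun ξ : Cotangent I M => ξ.2)
      contMDiff_id (X.contMDiff.comp (contMDiff_proj _)))

end Basic

section OfTensorial

variable {E : Type*} [NormedAddCommGroup E] [NormedSpace ℝ E] [FiniteDimensional ℝ E]
  {H : Type*} [TopologicalSpace H]
  {I : ModelWithCorners ℝ E H} {M : Type*} [TopologicalSpace M] [ChartedSpace H M] [T2Space M]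
  [IsManifold I ∞ M]

/-- A smooth vector field with a prescribed value at a point. -/
def extField (x : M) (v : TangentSpace I x) : VField I M :=
  (exists_section_eq (I := I) (V := (TangentSpace I : M → Type _)) x v).choose

theorem extField_apply (x : M) (v : TangentSpace I x) : extField x v x = v :=
  (exists_section_eq (I := I) (V := (TangentSpace I : M → Type _)) x v).choose_spec

/-- The one-form attached to a function-linear map from vector fields to functions; it is
characterized by `pairing_ofTensorial`. -/
def ofTensorial (φ : VField I M → Fn I M) (hadd : ∀ X Y, φ (X + Y) = φ X + φ Y)
    (hsmul : ∀ (f : Fn I M) X, φ (f • X) = f * φ X) : OneForm I M where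
  toFun x :=
    haveI : FiniteDimensional ℝ (TangentSpace I x) := inferInstanceAs (FiniteDimensional ℝ E)
    haveI : T2Space (TangentSpace I x) := inferInstanceAs (T2Space E)
    LinearMap.toContinuousLinearMap (E := TangentSpace I x)
    { toFun := fun v => φ (extField x v) x
      map_add' := fun u v => by
        have h : φ (extField x u + extField x v) x = φ (extField x u) x + φ (extField x v) x := by
          rw [hadd]; rfl
        refine Eq.trans (apply_eq_of_eq hadd hsmul ?_) h
        rw [extField_apply]
        change _ = extField x u x + extField x v x
        rw [extField_apply, extField_apply]
      map_smul' := fun c v => by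
        let C : Fn I M := ⟨fun _ => c, contMDiff_const⟩
        have h : φ (C • extField x v) x = c * φ (extField x v) x := by
          rw [hsmul]; rfl
        refine Eq.trans (apply_eq_of_eq hadd hsmul ?_) h
        rw [extField_apply]
        change _ = c • extField x v x
        rw [extField_apply] }
  contMDiff_toFun := by
    intro x₀
    rw [contMDiffAt_hom_bundle]
    refine ⟨contMDiffAt_id, ?_⟩
    obtain ⟨s, hs⟩ := apply_eq_sum hadd hsmul x₀
    let b := Module.finBasis ℝ E
    have h1 : ContMDiffAt I 𝓘(ℝ, E →L[ℝ] ℝ) ∞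
        (fun y => ∑ i, φ (s i) y • (LinearMap.toContinuousLinearMap (b.coord i))) x₀ :=
      ContMDiffAt.sum fun i _ => ((φ (s i)).contMDiff.contMDiffAt).smul contMDiffAt_const
    refine h1.congr_of_eventuallyEq ?_
    have hb := (trivializationAt E (TangentSpace I : M → Type _) x₀).open_baseSet.mem_nhds
      (FiberBundle.mem_baseSet_trivializationAt E (TangentSpace I : M → Type _) x₀)
    filter_upwards [hs, hb] with y hy hyb
    ext v
    have hv := hy (extField y ((trivializationAt E (TangentSpace I : M → Type _) x₀).symm y v))
    rw [extField_apply, Trivialization.apply_mk_symm _ hyb] at hv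
    simp only [ContinuousLinearMap.inCoordinates, ContinuousLinearMap.coe_comp, Function.comp_apply,
      Trivialization.symmL_apply _ hyb]
    refine Eq.trans ?_ (hv.trans ?_)
    · simp
    · simp [b, mul_comm]

@[simp] theorem pairing_ofTensorial (φ : VField I M → Fn I M) (hadd hsmul) (X : VField I M) :
    pairing (ofTensorial φ hadd hsmul) X = φ X := by
  ext x
  exact apply_eq_of_eq hadd hsmul
    (extField_apply x (X x))

end OfTensorial

/-! ### Symmetric contravariant tensor fields -/

section SymTensor

variable {E : Type*} [NormedAddCommGroup E] [NormedSpace ℝ E]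
  {H : Type*} [TopologicalSpace H]
  (I : ModelWithCorners ℝ E H) (M : Type*) [TopologicalSpace M] [ChartedSpace H M]
  [IsManifold I ∞ M]

/-- Smooth symmetric `k`-contravariant tensor fields on `M`. -/
@[ext] structure SymTensor (k : ℕ) where
  /-- The symmetric multilinear form on each cotangent space. -/
  form : ∀ x : M, MultilinearMap ℝ (fun _ : Fin k => TangentSpace I x →L[ℝ] ℝ) ℝ
  symm : ∀ x (σ : Equiv.Perm (Fin k)) (v : Fin k → (TangentSpace I x →L[ℝ] ℝ)),
    form x (fun i => v (σ i)) = form x v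
  smooth : ∀ α : Fin k → OneForm I M,
    ContMDiff I 𝓘(ℝ, ℝ) ∞ (fun x => form x (fun i => α i x))

variable {I M}

namespace SymTensor

variable {k : ℕ}

/-- The function `Q(α₁, …, α_k)` on `M`. -/
def eval (Q : SymTensor I M k) (α : Fin k → OneForm I M) : Fn I M :=
  ⟨fun x => Q.form x (fun i => α i x), Q.smooth α⟩

instance : Zero (SymTensor I M k) :=
  ⟨⟨fun _ => 0, fun _ _ _ => rfl, fun _ => contMDiff_const⟩⟩

instance : Add (SymTensor I M k) :=
  ⟨fun Q R => ⟨fun x => Q.form x + R.form x,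
    fun x σ v => congrArg₂ (· + ·) (Q.symm x σ v) (R.symm x σ v),
    fun α => (Q.smooth α).add (R.smooth α)⟩⟩

instance : Neg (SymTensor I M k) :=
  ⟨fun Q => ⟨fun x => -Q.form x, fun x σ v => congrArg (fun t : ℝ => -t) (Q.symm x σ v),
    fun α => (Q.smooth α).neg⟩⟩

instance : Sub (SymTensor I M k) :=
  ⟨fun Q R => ⟨fun x => Q.form x - R.form x,
    fun x σ v => congrArg₂ (· - ·) (Q.symm x σ v) (R.symm x σ v),
    fun α => (Q.smooth α).sub (R.smooth α)⟩⟩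

instance : SMul (Fn I M) (SymTensor I M k) :=
  ⟨fun f Q => ⟨fun x => f x • Q.form x,
    fun x σ v => congrArg (fun t : ℝ => f x * t) (Q.symm x σ v),
    fun α => f.contMDiff.mul (Q.smooth α)⟩⟩

end SymTensor

/-- The symmetric product `X ⊙ Y = ½ (X ⊗ Y + Y ⊗ X)` of vector fields. -/
def symProd (X Y : VField I M) : SymTensor I M 2 where
  form x :=
    { toFun := fun v => (1 / 2) * (v 0 (X x) * v 1 (Y x) + v 0 (Y x) * v 1 (X x))
      map_update_add' := by
        intro _ v i a b
        fin_cases i <;> simp <;> ring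
      map_update_smul' := by
        intro _ v i c a
        fin_cases i <;> simp <;> ring }
  symm x σ v := by
    have : σ 0 = 0 ∧ σ 1 = 1 ∨ σ 0 = 1 ∧ σ 1 = 0 := by
      have := σ.injective.ne (show (0 : Fin 2) ≠ 1 by decide)
      omega
    rcases this with ⟨h0, h1⟩ | ⟨h0, h1⟩ <;> simp [h0, h1]
    ring
  smooth α := contMDiff_const.mul
    (((pairing (α 0) X).contMDiff.mul (pairing (α 1) Y).contMDiff).add
      ((pairing (α 0) Y).contMDiff.mul (pairing (α 1) X).contMDiff))

variable [FiniteDimensional ℝ E] [T2Space M]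

/-- The fibrewise homogeneous polynomial `Q̃` of degree `k` on the cotangent bundle given by a
symmetric `k`-contravariant tensor field `Q`, namely `Q̃(ξ) = Q(ξ, …, ξ)`. -/
def poly {k : ℕ} (Q : SymTensor I M k) : Fn (cotModel E I) (Cotangent I M) where
  val ξ := Q.form ξ.1 (fun _ => ξ.2)
  property := by
    classical
    intro ξ₀
    let F := E →L[ℝ] ℝ
    let V := fun x : M => TangentSpace I x →L[ℝ] ℝ
    let b := Module.finBasis ℝ F
    obtain ⟨ψ, s, hψ, -, hs⟩ := exists_frame (I := I) (V := V) b ξ₀.1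
    let c := fun (i : Fin (Module.finrank ℝ F)) (ξ : Cotangent I M) =>
      b.repr (trivializationAt F V ξ₀.1 ξ).2 i
    have hc : ∀ i, ContMDiffAt (cotModel E I) 𝓘(ℝ, ℝ) ∞ (c i) ξ₀ := fun i =>
      ((LinearMap.toContinuousLinearMap (b.coord i)).contMDiff.contMDiffAt).comp ξ₀
        (contMDiffAt_totalSpace.1 (contMDiffAt_id (x := ξ₀))).2
    have h1 : ContMDiffAt (cotModel E I) 𝓘(ℝ, ℝ) ∞
        (fun ξ : Cotangent I M => ∑ r : Fin k → Fin (Module.finrank ℝ F),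
          (∏ j, c (r j) ξ) * Q.eval (fun j => s (r j)) ξ.1) ξ₀ := by
      refine ContMDiffAt.sum fun r _ => ?_
      refine ContMDiffAt.mul (contMDiffAt_finsetProd fun j _ => hc (r j)) ?_
      exact ((Q.eval _).contMDiff.comp (contMDiff_proj V)).contMDiffAt
    refine h1.congr_of_eventuallyEq ?_
    have hπ : ∀ᶠ ξ in 𝓝 ξ₀, ψ (ξ : Cotangent I M).1 = 1 :=
      (FiberBundle.continuous_proj F V).continuousAt.eventually hψ
    filter_upwards [hπ] with ξ hξ
    have h2 : ξ.2 = ∑ i, c i ξ • s i ξ.1 := by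
      have := hs ξ.1 ξ.2
      rwa [hξ, one_smul] at this
    calc Q.form ξ.1 (fun _ => ξ.2) = Q.form ξ.1 (fun _ => ∑ i, c i ξ • s i ξ.1) := by rw [← h2]
      _ = _ := by
        rw [MultilinearMap.map_sum]
        exact Finset.sum_congr rfl fun r _ => MultilinearMap.map_smul_univ _ _ _

end SymTensor

/-! ### Bivector fields and Poisson structures -/

section Bivector

variable {E : Type*} [NormedAddCommGroup E] [NormedSpace ℝ E]
  {H : Type*} [TopologicalSpace H]
  (I : ModelWithCorners ℝ E H) (M : Type*) [TopologicalSpace M] [ChartedSpace H M]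
  [IsManifold I ∞ M]

/-- Smooth bivector fields `w`, encoded by the skew-symmetric bundle map `♯ : T*M → TM`
with `⟨β, ♯α⟩ = w(α, β)`. -/
@[ext] structure Bivector where
  /-- The map `♯` on each cotangent space. -/
  sharp : ∀ x : M, (TangentSpace I x →L[ℝ] ℝ) →ₗ[ℝ] TangentSpace I x
  skew : ∀ x (α β : TangentSpace I x →L[ℝ] ℝ), β (sharp x α) = -α (sharp x β)
  smooth : ∀ α : OneForm I M,
    ContMDiff I (I.prod 𝓘(ℝ, E)) ∞ (fun x => TotalSpace.mk' E x (sharp x (α x)))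

variable {I M}

namespace Bivector

variable (w : Bivector I M)

/-- The vector field `♯α`. -/
def sharpField (α : OneForm I M) : VField I M := ⟨fun x => w.sharp x (α x), w.smooth α⟩

/-- The bracket `{f, g} = w(df, dg)`. -/
def bracket (f g : Fn I M) : Fn I M := fieldDeriv (w.sharpField (diff f)) g

/-- A bivector field is a Poisson structure if its bracket satisfies the Jacobi identity. -/
def IsPoisson : Prop := ∀ f g h : Fn I M,
  w.bracket (w.bracket f g) h + w.bracket (w.bracket g h) f + w.bracket (w.bracket h f) g = 0

variable [FiniteDimensional ℝ E] [T2Space M]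

/-- The bracket of one-forms defined by a bivector field,
`[α, β] = L_{♯α} β - L_{♯β} α - d(w(α, β))`, evaluated on vector fields through the formula
`(L_X β)(Y) = X⟨β, Y⟩ - ⟨β, [X, Y]⟩`. -/
def formBracket (α β : OneForm I M) : OneForm I M :=
  haveI : CompleteSpace E := FiniteDimensional.complete ℝ E
  ofTensorial
    (fun Y =>
      (fieldDeriv (w.sharpField α) (pairing β Y) - pairing β (lieBracket (w.sharpField α) Y))
      - (fieldDeriv (w.sharpField β) (pairing α Y) - pairing α (lieBracket (w.sharpField β) Y))
      - fieldDeriv Y (pairing β (w.sharpField α)))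
    (by
      intro X Y
      simp only [pairing_add, fieldDeriv_add, lieBracket_add]
      have : ∀ f : Fn I M, fieldDeriv (X + Y) f = fieldDeriv X f + fieldDeriv Y f :=
        fun f => pairing_add _ _ _
      rw [this]
      ring)
    (by
      intro f X
      simp only [pairing_smul, fieldDeriv_mul, lieBracket_smul, pairing_add]
      have : ∀ g : Fn I M, fieldDeriv (f • X) g = f * fieldDeriv X g :=
        fun g => pairing_smul _ _ _
      rw [this]
      ring)

end Bivector

/-- A bivector field on the cotangent bundle is graded if its bracket sends a pair of fibrewise
homogeneous polynomials of degrees `h` and `k` to one of degree `h + k`. -/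
def IsGraded [FiniteDimensional ℝ E] [T2Space M] (W : Bivector (cotModel E I) (Cotangent I M)) :
    Prop :=
  ∀ (h k : ℕ) (Q : SymTensor I M h) (R : SymTensor I M k),
    ∃ P : SymTensor I M (h + k), W.bracket (poly Q) (poly R) = poly P

/-- Contravariant connections on `(M, w)`: contravariant derivatives on `TM`. -/
@[ext] structure ContravariantConnection (w : Bivector I M) where
  /-- The vector field `D_α X`. -/
  D : OneForm I M → VField I M → VField I M
  add_left : ∀ α β X, D (α + β) X = D α X + D β X
  add_right : ∀ α X Y, D α (X + Y) = D α X + D α Y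
  smul_left : ∀ (f : Fn I M) α X, D (f • α) X = f • D α X
  leibniz : ∀ α (f : Fn I M) X, D α (f • X) = f • D α X + fieldDeriv (w.sharpField α) f • X

end Bivector

section Connection

variable {E : Type*} [NormedAddCommGroup E] [NormedSpace ℝ E] [FiniteDimensional ℝ E]
  {H : Type*} [TopologicalSpace H]
  {I : ModelWithCorners ℝ E H} {M : Type*} [TopologicalSpace M] [ChartedSpace H M] [T2Space M]
  [IsManifold I ∞ M]

namespace ContravariantConnection

variable {w : Bivector I M} (D : ContravariantConnection w)

/-- The vanishing of the curvature `D_α D_β - D_β D_α - D_{[α, β]}`. -/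
def IsFlat : Prop := ∀ α β X,
  D.D α (D.D β X) - D.D β (D.D α X) - D.D (w.formBracket α β) X = 0

/-- The derivative of a one-form: `⟨D_α β, X⟩ = ♯α ⟨β, X⟩ - ⟨β, D_α X⟩`. -/
def formDeriv (α β : OneForm I M) : OneForm I M :=
  ofTensorial
    (fun X => fieldDeriv (w.sharpField α) (pairing β X) - pairing β (D.D α X))
    (by
      intro X Y
      simp only [pairing_add, fieldDeriv_add, D.add_right]
      ring)
    (by
      intro f X
      simp only [pairing_smul, fieldDeriv_mul, D.leibniz, pairing_add]
      ring)

/-- The derivative of a symmetric contravariant tensor field, evaluated on one-forms: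
`(D_α Q)(β₁, …, β_k) = ♯α (Q(β₁, …, β_k)) - ∑ᵢ Q(β₁, …, D_α βᵢ, …, β_k)`. -/
def tensorDeriv {k : ℕ} (α : OneForm I M) (Q : SymTensor I M k) (β : Fin k → OneForm I M) :
    Fn I M :=
  fieldDeriv (w.sharpField α) (Q.eval β) -
    ∑ i, Q.eval (Function.update β i (D.formDeriv α (β i)))

end ContravariantConnection

/-- Operators `Ψ` sending two vector fields to a symmetric `2`-contravariant tensor field which are
biadditive, skew-symmetric, and of the first order with symbol prescribed by the connection:
`Ψ(X, fY) = f Ψ(X, Y) - (D_{df} X) ⊙ Y`. -/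
@[ext] structure PsiOperator {w : Bivector I M} (D : ContravariantConnection w) where
  /-- The tensor field `Ψ(X, Y)`. -/
  Ψ : VField I M → VField I M → SymTensor I M 2
  add_right : ∀ X Y Z, Ψ X (Y + Z) = Ψ X Y + Ψ X Z
  skew : ∀ X Y, Ψ Y X = -Ψ X Y
  leibniz : ∀ X (f : Fn I M) Y, Ψ X (f • Y) = f • Ψ X Y - symProd (D.D (diff f) X) Y

/-- `D_{df} Ψ = 0` for all `f`, where
`(D_{df} Ψ)(X, Y) = D_{df} (Ψ(X, Y)) - Ψ(D_{df} X, Y) - Ψ(X, D_{df} Y)`. -/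
def PsiOperator.IsParallel {w : Bivector I M} {D : ContravariantConnection w}
    (P : PsiOperator D) : Prop :=
  ∀ (f : Fn I M) (X Y : VField I M) (β : Fin 2 → OneForm I M),
    D.tensorDeriv (diff f) (P.Ψ X Y) β - (P.Ψ (D.D (diff f) X) Y).eval β
      - (P.Ψ X (D.D (diff f) Y)).eval β = 0

variable (I M) in
/-- The data carried by the base manifold. -/
@[ext] structure BaseData where
  /-- The bivector field on the base. -/
  w : Bivector I M
  /-- The contravariant connection. -/
  D : ContravariantConnection w
  /-- The operator `Ψ`. -/
  P : PsiOperator D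
  /-- The operator `Θ`. -/
  Θ : SymTensor I M 2 → VField I M → SymTensor I M 3

/-- The base data are those defined by the bracket of the bivector field `W` on `T*M`. -/
structure Induces (W : Bivector (cotModel E I) (Cotangent I M)) (d : BaseData I M) : Prop where
  basic_basic : ∀ f g : Fn I M, W.bracket (basic f) (basic g) = basic (d.w.bracket f g)
  momentum_basic : ∀ (X : VField I M) (f : Fn I M),
    W.bracket (momentum X) (basic f) = -momentum (d.D.D (diff f) X)
  momentum_momentum : ∀ X Y : VField I M,
    W.bracket (momentum X) (momentum Y) = poly (d.P.Ψ X Y)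
  quadratic_momentum : ∀ (G : SymTensor I M 2) (X : VField I M),
    W.bracket (poly G) (momentum X) = poly (d.Θ G X)

/-- `w` is Poisson, `D` is flat, `D_{df} Ψ = 0`, and `∑ Θ(Ψ(X, Y), Z) = 0` (cyclic sum). -/
structure BaseData.IsIntegrable (d : BaseData I M) : Prop where
  poisson : d.w.IsPoisson
  flat : d.D.IsFlat
  parallel : d.P.IsParallel
  cyclic : ∀ X Y Z : VField I M,
    d.Θ (d.P.Ψ X Y) Z + d.Θ (d.P.Ψ Y Z) X + d.Θ (d.P.Ψ Z X) Y = 0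

end Connection

end GradedPoisson

end

noncomputable section

namespace GradedPoisson

section Differential

variable {E : Type*} [NormedAddCommGroup E] [NormedSpace ℝ E]
  {H : Type*} [TopologicalSpace H]
  {I : ModelWithCorners ℝ E H} {M : Type*} [TopologicalSpace M] [ChartedSpace H M]
  [IsManifold I ∞ M]

theorem diff_apply (f : Fn I M) (x : M) : diff f x = mvfderiv I f x := rfl

theorem mdifferentiableAt_fn (f : Fn I M) (x : M) : MDifferentiableAt I 𝓘(ℝ, ℝ) f x :=
  f.contMDiff.mdifferentiableAt (by simp)

theorem diff_add (f g : Fn I M) : diff (f + g) = diff f + diff g := by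
  ext x : 1
  exact mvfderiv_add (mdifferentiableAt_fn f x) (mdifferentiableAt_fn g x)

theorem diff_mul (f g : Fn I M) : diff (f * g) = f • diff g + g • diff f := by
  ext x : 1
  exact mvfderiv_mul (mdifferentiableAt_fn f x) (mdifferentiableAt_fn g x)

theorem diff_apply_congr {f g : Fn I M} {x : M} (h : f =ᶠ[𝓝 x] g) : diff f x = diff g x := by
  rw [diff_apply, diff_apply, mvfderiv, mvfderiv, h.mfderiv_eq, h.eq_of_nhds]

/-- The constant function. -/
def constFn (c : ℝ) : Fn I M := ⟨fun _ => c, contMDiff_const⟩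

@[simp] theorem constFn_apply (c : ℝ) (x : M) : (constFn c : Fn I M) x = c := rfl

theorem diff_const (c : ℝ) : diff (constFn c : Fn I M) = 0 := by
  ext x : 1
  exact mvfderiv_const c

theorem diff_const_smul (c : ℝ) (f : Fn I M) (x : M) : diff (c • f) x = c • diff f x := by
  have h : c • f = (constFn c : Fn I M) * f := rfl
  rw [h, diff_mul, diff_const]
  ext v
  simp

variable (I) in
/-- The differential at a point as a linear map. -/
def diffAt (x : M) : Fn I M →ₗ[ℝ] (TangentSpace I x →L[ℝ] ℝ) where
  toFun f := diff f x
  map_add' f g := by rw [diff_add]; rfl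
  map_smul' c f := diff_const_smul c f x

theorem diffAt_apply (x : M) (f : Fn I M) : diffAt I x f = diff f x := rfl

theorem diff_comp {E' : Type*} [NormedAddCommGroup E'] [NormedSpace ℝ E']
    {H' : Type*} [TopologicalSpace H'] {J : ModelWithCorners ℝ E' H'}
    {N : Type*} [TopologicalSpace N] [ChartedSpace H' N] [IsManifold J ∞ N]
    (f : Fn I M) (φ : C^∞⟮J, N; I, M⟯) (y : N) :
    diff (f.comp φ) y = (diff f (φ y)).comp (mfderiv J I φ y) :=
  mvfderiv_comp y (mdifferentiableAt_fn f _) (φ.contMDiff.mdifferentiableAt (by simp))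

theorem fieldDeriv_add_left (X Y : VField I M) (f : Fn I M) :
    fieldDeriv (X + Y) f = fieldDeriv X f + fieldDeriv Y f := pairing_add _ _ _

theorem fieldDeriv_smul_left (g : Fn I M) (X : VField I M) (f : Fn I M) :
    fieldDeriv (g • X) f = g * fieldDeriv X f := pairing_smul _ _ _

theorem fieldDeriv_lieBracket [CompleteSpace E] (X Y : VField I M) (f : Fn I M) :
    fieldDeriv (lieBracket X Y) f =
      fieldDeriv X (fieldDeriv Y f) - fieldDeriv Y (fieldDeriv X f) := by
  have key : ∀ Z : VField I M, fieldDeriv (lieBracket X Y) f • Z =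
      (fieldDeriv X (fieldDeriv Y f) - fieldDeriv Y (fieldDeriv X f)) • Z := by
    intro Z
    have jac : ∀ U V W : VField I M, lieBracket U (lieBracket V W) =
        lieBracket (lieBracket U V) W + lieBracket V (lieBracket U W) := by
      intro U V W
      have h2 : minSmoothness ℝ 2 ≤ (∞ : ℕ∞ω) := by
        simpa using (mod_cast le_top : ((2 : ℕ∞) : ℕ∞ω) ≤ ∞)
      have : IsManifold I (minSmoothness ℝ 3) M :=
        IsManifold.of_le (n := ∞) (by simpa using (mod_cast le_top : ((3 : ℕ∞) : ℕ∞ω) ≤ ∞))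
      ext x
      exact congrFun (VectorField.leibniz_identity_mlieBracket (U.contMDiff.of_le h2)
        (V.contMDiff.of_le h2) (W.contMDiff.of_le h2)) x
    have h := jac X Y (f • Z)
    simp only [lieBracket_smul, lieBracket_add, jac X Y Z] at h
    ext x
    have hx := congrArg (fun V : VField I M => V x) h
    simp only [ContMDiffSection.coe_add, Pi.add_apply, smul_section_apply, smul_add] at hx ⊢
    change _ = (fieldDeriv X (fieldDeriv Y f) x - fieldDeriv Y (fieldDeriv X f) x) • Z x
    rw [sub_smul, eq_sub_iff_add_eq]
    have := sub_eq_zero.2 hx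
    rw [← sub_eq_zero, ← neg_eq_zero, ← this]
    module
  have cancel : ∀ (a b : Fn I M) (Z : VField I M) (x : M), Z x ≠ 0 → a • Z = b • Z → a x = b x := by
    intro a b Z x hZ h
    exact smul_left_injective ℝ hZ (congrArg (fun V : VField I M => V x) h)
  ext x
  by_cases hX : X x = 0
  · by_cases hY : Y x = 0
    · have h0 : lieBracket X Y x = 0 := VectorField.mlieBracketWithin_eq_zero_of_eq_zero hX hY
      change diff f x (lieBracket X Y x) =
        diff (fieldDeriv Y f) x (X x) - diff (fieldDeriv X f) x (Y x)
      rw [h0, hX, hY]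
      simp
    · exact cancel _ _ Y x hY (key Y)
  · exact cancel _ _ X x hX (key X)

/-- Smooth functions that express the chart at `x₀` near `x₀`. -/
def IsCoordinates {ι : Type*} (F : ι → Fn I M) (x₀ : M) : Prop :=
  ∃ L : E →ₗ[ℝ] (ι → ℝ), Function.Injective L ∧ ∀ᶠ y in 𝓝 x₀, ∀ j, F j y = L (extChartAt I x₀ y) j

end Differential

section Coordinates

variable {E : Type*} [NormedAddCommGroup E] [NormedSpace ℝ E] [FiniteDimensional ℝ E]
  {H : Type*} [TopologicalSpace H]
  {I : ModelWithCorners ℝ E H} {M : Type*} [TopologicalSpace M] [ChartedSpace H M]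
  [IsManifold I ∞ M] {ι : Type*} [Finite ι]

theorem diff_eq_of_eventuallyEq_chart (F : Fn I M) (x₀ : M) (l : E →L[ℝ] ℝ)
    (h : ∀ᶠ y in 𝓝 x₀, F y = l (extChartAt I x₀ y)) :
    ∀ᶠ y in 𝓝 x₀, ∀ v : TangentSpace I y,
      diff F y v = l (trivializationAt E (TangentSpace I : M → Type _) x₀ ⟨y, v⟩).2 := by
  have hs := (chartAt H x₀).open_source.mem_nhds (mem_chart_source H x₀)
  filter_upwards [h.eventually_nhds, hs] with y hy hys v
  have h1 : mfderiv I 𝓘(ℝ, ℝ) F y =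
      (mfderiv 𝓘(ℝ, E) 𝓘(ℝ, ℝ) l (extChartAt I x₀ y)).comp
        (mfderiv I 𝓘(ℝ, E) (extChartAt I x₀) y) := by
    rw [← mfderiv_comp y l.mdifferentiableAt
      ((contMDiffAt_extChartAt' (n := 1) hys).mdifferentiableAt one_ne_zero)]
    exact Filter.EventuallyEq.mfderiv_eq hy
  have h2 : mfderiv I 𝓘(ℝ, E) (extChartAt I x₀) y v =
      (trivializationAt E (TangentSpace I : M → Type _) x₀ ⟨y, v⟩).2 := by
    rw [← TangentBundle.continuousLinearMapAt_trivializationAt hys]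
    have hb : y ∈ (trivializationAt E (TangentSpace I : M → Type _) x₀).baseSet := hys
    exact congrFun (Trivialization.coe_linearMapAt_of_mem (R := ℝ) _ hb) v
  change mfderiv I 𝓘(ℝ, ℝ) F y v = _
  rw [h1, mfderiv_eq_fderiv, l.fderiv]
  exact congrArg l h2

theorem IsCoordinates.diff_eq {F : ι → Fn I M} {x₀ : M} (hF : IsCoordinates F x₀) :
    ∃ L : E →ₗ[ℝ] (ι → ℝ), Function.Injective L ∧
      ∀ᶠ y in 𝓝 x₀, ∀ (v : TangentSpace I y) j,
      diff (F j) y v = L (trivializationAt E (TangentSpace I : M → Type _) x₀ ⟨y, v⟩).2 j := by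
  obtain ⟨L, hL, h⟩ := hF
  refine ⟨L, hL, ?_⟩
  have : ∀ j, ∀ᶠ y in 𝓝 x₀, ∀ v : TangentSpace I y,
      diff (F j) y v = L (trivializationAt E (TangentSpace I : M → Type _) x₀ ⟨y, v⟩).2 j :=
    fun j => diff_eq_of_eventuallyEq_chart (F j) x₀
      (LinearMap.toContinuousLinearMap ((LinearMap.proj j : (ι → ℝ) →ₗ[ℝ] ℝ) ∘ₗ L))
      (h.mono fun y hy => hy j)
  exact (Filter.eventually_all.2 this).mono fun y hy v j => hy j v

theorem IsCoordinates.eq_zero {F : ι → Fn I M} {x₀ : M} (hF : IsCoordinates F x₀)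
    {v : TangentSpace I x₀} (hv : ∀ j, diff (F j) x₀ v = 0) : v = 0 := by
  obtain ⟨L, hL, h⟩ := hF.diff_eq
  have h1 : (trivializationAt E (TangentSpace I : M → Type _) x₀ ⟨x₀, v⟩).2 = 0 := by
    apply hL
    ext j
    rw [← h.self_of_nhds v j, hv j, map_zero]
    rfl
  have := (trivializationAt E (TangentSpace I : M → Type _) x₀).symm_apply_apply_mk
    (FiberBundle.mem_baseSet_trivializationAt E (TangentSpace I : M → Type _) x₀) v
  rw [← this, h1]
  rw [← Trivialization.coe_symmₗ (R := ℝ), map_zero]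
  exact FiberBundle.mem_baseSet_trivializationAt E (TangentSpace I : M → Type _) x₀

theorem IsCoordinates.contMDiffAt {F : ι → Fn I M} {x₀ : M} (hF : IsCoordinates F x₀)
    {V : ∀ x : M, TangentSpace I x}
    (hV : ∀ j, ContMDiffAt I 𝓘(ℝ, ℝ) ∞ (fun x => diff (F j) x (V x)) x₀) :
    ContMDiffAt I (I.prod 𝓘(ℝ, E)) ∞ (fun x => TotalSpace.mk' E x (V x)) x₀ := by
  obtain ⟨L, hL, h⟩ := hF.diff_eq
  obtain ⟨R, hR⟩ := L.exists_leftInverse_of_injective (LinearMap.ker_eq_bot.2 hL)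
  have := Fintype.ofFinite ι
  refine contMDiffAt_totalSpace.2 ⟨contMDiffAt_id, ?_⟩
  have h1 : ContMDiffAt I 𝓘(ℝ, ι → ℝ) ∞ (fun x j => diff (F j) x (V x)) x₀ :=
    contMDiffAt_pi_space.2 hV
  refine ((LinearMap.toContinuousLinearMap R).contMDiff.contMDiffAt.comp x₀
    h1).congr_of_eventuallyEq (h.mono fun y hy => ?_)
  have : (fun j => diff (F j) y (V y)) =
      L (trivializationAt E (TangentSpace I : M → Type _) x₀ ⟨y, V y⟩).2 := by
    ext j
    exact hy _ j
  change _ = R (fun j => diff (F j) y (V y))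
  rw [this]
  exact (LinearMap.congr_fun hR _).symm

variable [T2Space M]

theorem exists_fn_eventuallyEq_chart (x₀ : M) (l : E →L[ℝ] ℝ) :
    ∃ f : Fn I M, ∀ᶠ y in 𝓝 x₀, f y = l (extChartAt I x₀ y) := by
  obtain ⟨ψ, -, hψ⟩ := (SmoothBumpFunction.nhds_basis_tsupport (I := I) x₀).mem_iff.1
    ((chartAt H x₀).open_source.mem_nhds (mem_chart_source H x₀))
  refine ⟨⟨fun y => ψ y * l (extChartAt I x₀ y), contMDiff_of_tsupport fun y hy => ?_⟩,
    ψ.eventuallyEq_one.mono fun y hy => ?_⟩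
  · exact ψ.contMDiff.contMDiffAt.mul (l.contMDiff.contMDiffAt.comp y
      (contMDiffAt_extChartAt' (hψ (tsupport_mul_subset_left hy))))
  · change ψ y * l (extChartAt I x₀ y) = _
    rw [hy]
    simp

/-- Local coordinates extended to global functions, with the corresponding frame. -/
theorem exists_coordinates (x₀ : M) :
    ∃ (f : Fin (Module.finrank ℝ E) → Fn I M) (X : Fin (Module.finrank ℝ E) → VField I M),
      IsCoordinates f x₀ ∧
      ∀ᶠ y in 𝓝 x₀, ∀ v : TangentSpace I y, v = ∑ i, diff (f i) y v • X i y := by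
  set b := Module.finBasis ℝ E
  choose f hf using fun i => exists_fn_eventuallyEq_chart (I := I) x₀
    (LinearMap.toContinuousLinearMap (b.coord i))
  obtain ⟨ψ, X, hψ, -, hX⟩ := exists_frame (I := I) (V := (TangentSpace I : M → Type _)) b x₀
  refine ⟨f, X, ⟨b.equivFun, b.equivFun.injective, ?_⟩, ?_⟩
  · exact (Filter.eventually_all.2 hf).mono fun y hy j => hy j
  · filter_upwards [Filter.eventually_all.2 fun i => diff_eq_of_eventuallyEq_chart _ _ _ (hf i), hψ]
      with y hy h1 v
    have := hX y v
    rw [h1, Pi.one_apply, one_smul] at this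
    refine this.trans (Finset.sum_congr rfl fun i _ => ?_)
    rw [hy i v]
    rfl

theorem coord_covector_eq (x₀ : M) :
    ∃ (f : Fin (Module.finrank ℝ E) → Fn I M) (X : Fin (Module.finrank ℝ E) → VField I M),
      ∀ᶠ y in 𝓝 x₀, ∀ ξ : TangentSpace I y →L[ℝ] ℝ, ξ = ∑ i, ξ (X i y) • diff (f i) y := by
  obtain ⟨f, X, -, h⟩ := exists_coordinates (I := I) x₀
  refine ⟨f, X, h.mono fun y hy ξ => ?_⟩
  ext v
  conv_lhs => rw [hy v, map_sum]
  simp [mul_comm]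

theorem exists_diff_eq (x : M) (α : TangentSpace I x →L[ℝ] ℝ) : ∃ f : Fn I M, diff f x = α := by
  obtain ⟨f, X, h⟩ := coord_covector_eq (I := I) x
  refine ⟨∑ i, α (X i x) • f i, ?_⟩
  rw [← diffAt_apply, map_sum]
  simpa only [map_smul, diffAt_apply] using (h.self_of_nhds α).symm

end Coordinates

section Polarization

variable {V : Type*} [AddCommGroup V] [Module ℝ V] {k : ℕ}

theorem sum_neg_one_pow_of_subset (R : Finset (Fin k)) :
    ∑ S : Finset (Fin k), (if R ⊆ S then (-1 : ℝ) ^ (k - S.card) else 0) =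
      if R = Finset.univ then 1 else 0 := by
  have h := Finset.prod_add (fun _ : Fin k => (1 : ℝ)) (fun i => if i ∈ R then 0 else -1)
    Finset.univ
  rw [Finset.powerset_univ] at h
  have h1 : ∀ S : Finset (Fin k), (∏ _i ∈ S, (1 : ℝ)) *
      ∏ i ∈ Finset.univ \ S, (if i ∈ R then (0 : ℝ) else -1) =
        if R ⊆ S then (-1 : ℝ) ^ (k - S.card) else 0 := by
    intro S
    rw [Finset.prod_const_one, one_mul]
    split_ifs with hS
    · rw [Finset.prod_congr rfl (g := fun _ => (-1 : ℝ)), Finset.prod_const,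
        Finset.card_sdiff_of_subset (Finset.subset_univ _), Finset.card_univ, Fintype.card_fin]
      intro i hi
      rw [if_neg fun hR => (Finset.mem_sdiff.1 hi).2 (hS hR)]
    · obtain ⟨i, hiR, hiS⟩ := Finset.not_subset.1 hS
      exact Finset.prod_eq_zero (i := i) (by simpa using hiS) (by simp [hiR])
  rw [← Finset.sum_congr rfl fun S _ => h1 S, ← h]
  split_ifs with hR
  · simp [hR]
  · obtain ⟨i, hi⟩ : ∃ i, i ∉ R := by
      by_contra! hc
      exact hR (Finset.eq_univ_iff_forall.2 hc)
    exact Finset.prod_eq_zero (Finset.mem_univ i) (by simp [hi])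

/-- The polarization formula for symmetric multilinear forms. -/
theorem factorial_smul_eq_sum_diag (g : MultilinearMap ℝ (fun _ : Fin k => V) ℝ)
    (hg : ∀ (σ : Equiv.Perm (Fin k)) v, g (fun i => v (σ i)) = g v) (v : Fin k → V) :
    (k.factorial : ℝ) * g v =
      ∑ S : Finset (Fin k), (-1 : ℝ) ^ (k - S.card) * g fun _ => ∑ i ∈ S, v i := by
  classical
  have h1 : ∀ S : Finset (Fin k), g (fun _ => ∑ i ∈ S, v i) =
      ∑ r : Fin k → Fin k, if Finset.univ.image r ⊆ S then g (fun i => v (r i)) else 0 := by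
    intro S
    rw [MultilinearMap.map_sum_finset, ← Finset.sum_filter]
    refine Finset.sum_congr ?_ fun _ _ => rfl
    ext r
    simp [Fintype.mem_piFinset, Finset.image_subset_iff]
  have h2 : ∀ r : Fin k → Fin k, Finset.univ.image r = Finset.univ ↔ Function.Bijective r :=
    fun r => by
      rw [Finset.eq_univ_iff_forall, ← Finite.surjective_iff_bijective]
      simp [Function.Surjective]
  calc (k.factorial : ℝ) * g v = ∑ σ : Equiv.Perm (Fin k), g (fun i => v (σ i)) := by
        simp [hg, Fintype.card_perm]
    _ = ∑ r : Fin k → Fin k, if Function.Bijective r then g (fun i => v (r i)) else 0 := by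
        rw [← Finset.sum_filter]
        refine Finset.sum_bij (fun σ _ => ⇑σ)
          (fun σ _ => Finset.mem_filter.2 ⟨Finset.mem_univ _, σ.bijective⟩)
          (fun σ _ τ _ h => DFunLike.coe_injective h) (fun r hr => ?_) fun _ _ => rfl
        exact ⟨Equiv.ofBijective r (Finset.mem_filter.1 hr).2, Finset.mem_univ _, rfl⟩
    _ = ∑ r : Fin k → Fin k, ∑ S : Finset (Fin k), (-1 : ℝ) ^ (k - S.card) *
          (if Finset.univ.image r ⊆ S then g (fun i => v (r i)) else 0) := by
        refine Finset.sum_congr rfl fun r _ => ?_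
        have := sum_neg_one_pow_of_subset (Finset.univ.image r)
        simp only [h2] at this
        rw [← one_mul (g _), ← zero_mul (g fun i => v (r i)), ← ite_mul, ← this, Finset.sum_mul]
        refine Finset.sum_congr rfl fun S _ => ?_
        split_ifs <;> simp
    _ = _ := by
        rw [Finset.sum_comm]
        simp_rw [h1, Finset.mul_sum]

theorem eq_of_diag_eq {g h : MultilinearMap ℝ (fun _ : Fin k => V) ℝ}
    (hg : ∀ (σ : Equiv.Perm (Fin k)) v, g (fun i => v (σ i)) = g v)
    (hh : ∀ (σ : Equiv.Perm (Fin k)) v, h (fun i => v (σ i)) = h v)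
    (H : ∀ v, g (fun _ => v) = h fun _ => v) : g = h := by
  ext v
  have h0 : (k.factorial : ℝ) ≠ 0 := Nat.cast_ne_zero.2 k.factorial_ne_zero
  refine mul_left_cancel₀ h0 ?_
  rw [factorial_smul_eq_sum_diag g hg, factorial_smul_eq_sum_diag h hh]
  simp only [H]

/-- Every multilinear form has the same diagonal as a symmetric one. -/
theorem exists_symm_diag_eq (μ : MultilinearMap ℝ (fun _ : Fin k => V) ℝ) :
    ∃ g : MultilinearMap ℝ (fun _ : Fin k => V) ℝ,
      (∀ (σ : Equiv.Perm (Fin k)) v, g (fun i => v (σ i)) = g v) ∧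
        ∀ v, g (fun _ => v) = μ fun _ => v := by
  refine ⟨(k.factorial : ℝ)⁻¹ • ∑ τ : Equiv.Perm (Fin k), μ.domDomCongr τ, ?_, ?_⟩
  · intro σ v
    simp only [smul_apply, sum_apply,
      MultilinearMap.domDomCongr_apply]
    congr 1
    exact Fintype.sum_equiv (Equiv.mulLeft σ) _ _ fun τ => rfl
  · intro v
    have h0 : (k.factorial : ℝ) ≠ 0 := Nat.cast_ne_zero.2 k.factorial_ne_zero
    simp [Fintype.card_perm, h0]

end Polarization

section CotangentFunctions

variable {E : Type*} [NormedAddCommGroup E] [NormedSpace ℝ E]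
  {H : Type*} [TopologicalSpace H]
  {I : ModelWithCorners ℝ E H} {M : Type*} [TopologicalSpace M] [ChartedSpace H M]
  [IsManifold I ∞ M]

@[simp] theorem basic_apply (f : Fn I M) (ξ : Cotangent I M) : basic f ξ = f ξ.1 := rfl

@[simp] theorem momentum_apply (X : VField I M) (ξ : Cotangent I M) :
    momentum X ξ = ξ.2 (X ξ.1) := rfl

theorem basic_add (f g : Fn I M) : basic (f + g) = basic f + basic g := rfl

theorem momentum_add (X Y : VField I M) : momentum (X + Y) = momentum X + momentum Y := by
  ext ξ
  exact map_add ξ.2 _ _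

theorem momentum_smul (f : Fn I M) (X : VField I M) :
    momentum (f • X) = basic f * momentum X := by
  ext ξ
  exact map_smul ξ.2 _ _

variable (I M) in
/-- `f ↦ f ∘ π` as a linear map. -/
def basicHom : Fn I M →ₗ[ℝ] Fn (cotModel E I) (Cotangent I M) where
  toFun := basic
  map_add' _ _ := rfl
  map_smul' _ _ := rfl

variable (I M) in
/-- The momentum as a linear map. -/
def momentumHom : VField I M →ₗ[ℝ] Fn (cotModel E I) (Cotangent I M) where
  toFun := momentum
  map_add' := momentum_add
  map_smul' c X := by
    ext ξ
    exact map_smul ξ.2 c _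

theorem basicHom_apply (f : Fn I M) : basicHom I M f = basic f := rfl

theorem momentumHom_apply (X : VField I M) : momentumHom I M X = momentum X := rfl

theorem momentum_sub (X Y : VField I M) : momentum (X - Y) = momentum X - momentum Y :=
  map_sub (momentumHom I M) X Y

theorem basic_injective : Function.Injective (basic : Fn I M → _) := by
  intro f g h
  ext x
  exact congrArg (fun F : Fn (cotModel E I) (Cotangent I M) => F ⟨x, 0⟩) h

/-- The projection of the cotangent bundle. -/
def proj : C^∞⟮cotModel E I, Cotangent I M; I, M⟯ := ⟨TotalSpace.proj, contMDiff_proj _⟩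

theorem diff_basic (f : Fn I M) (ξ : Cotangent I M) :
    diff (basic f) ξ = (diff f ξ.1).comp (mfderiv (cotModel E I) I TotalSpace.proj ξ) :=
  diff_comp f proj ξ

variable [FiniteDimensional ℝ E] [T2Space M]

@[simp] theorem poly_apply {k : ℕ} (Q : SymTensor I M k) (ξ : Cotangent I M) :
    poly Q ξ = Q.form ξ.1 (fun _ => ξ.2) := rfl

theorem momentum_injective : Function.Injective (momentum : VField I M → _) := by
  intro X Y h
  ext x
  obtain ⟨f, -, hf, -⟩ := exists_coordinates (I := I) x
  refine sub_eq_zero.1 (hf.eq_zero (v := X x - Y x) fun j => ?_)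
  rw [map_sub, sub_eq_zero]
  exact congrArg (fun F : Fn (cotModel E I) (Cotangent I M) => F ⟨x, diff (f j) x⟩) h

theorem poly_injective {k : ℕ} : Function.Injective (poly : SymTensor I M k → _) := by
  intro Q R h
  ext x : 2
  refine eq_of_diag_eq (Q.symm x) (R.symm x) fun ξ => ?_
  exact congrArg (fun F : Fn (cotModel E I) (Cotangent I M) => F ⟨x, ξ⟩) h

theorem exists_poly_eq {k : ℕ} (G : Fn (cotModel E I) (Cotangent I M))
    (hG : ∀ x : M, ∃ μ : MultilinearMap ℝ (fun _ : Fin k => TangentSpace I x →L[ℝ] ℝ) ℝ,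
      ∀ ξ, G ⟨x, ξ⟩ = μ fun _ => ξ) : ∃ P : SymTensor I M k, G = poly P := by
  have h1 : ∀ x : M, ∃ μ : MultilinearMap ℝ (fun _ : Fin k => TangentSpace I x →L[ℝ] ℝ) ℝ,
      (∀ (σ : Equiv.Perm (Fin k)) v, μ (fun i => v (σ i)) = μ v) ∧
      ∀ ξ, G ⟨x, ξ⟩ = μ fun _ => ξ := by
    intro x
    obtain ⟨μ, hμ⟩ := hG x
    obtain ⟨g, hg, hgμ⟩ := exists_symm_diag_eq μ
    exact ⟨g, hg, fun ξ => (hμ ξ).trans (hgμ ξ).symm⟩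
  choose g hg hGg using h1
  refine ⟨⟨g, hg, fun α => ?_⟩, by ext ξ; exact hGg ξ.1 ξ.2⟩
  have h2 : (fun x => g x fun i => α i x) = fun x => (k.factorial : ℝ)⁻¹ *
      ∑ S : Finset (Fin k), (-1 : ℝ) ^ (k - S.card) * G ⟨x, (∑ i ∈ S, α i) x⟩ := by
    funext x
    have h0 : (k.factorial : ℝ) ≠ 0 := Nat.cast_ne_zero.2 k.factorial_ne_zero
    rw [eq_inv_mul_iff_mul_eq₀ h0, factorial_smul_eq_sum_diag (g x) (hg x)]
    refine Finset.sum_congr rfl fun S _ => ?_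
    rw [hGg]
    have : (∑ i ∈ S, α i) x = ∑ i ∈ S, α i x := by
      change ContMDiffSection.coeAddHom I (E →L[ℝ] ℝ) ∞ _ _ x = _
      rw [map_sum, Finset.sum_apply]
      rfl
    rw [this]
  rw [h2]
  refine contMDiff_const.mul ?_
  refine contMDiff_finsetSum fun S _ => contMDiff_const.mul ?_
  exact G.contMDiff.comp (∑ i ∈ S, α i : OneForm I M).contMDiff

/-- A smooth fibrewise linear function on the cotangent bundle is a momentum. -/
theorem exists_momentum_eq (G : Fn (cotModel E I) (Cotangent I M))
    (hG : ∀ x : M, ∃ l : (TangentSpace I x →L[ℝ] ℝ) →ₗ[ℝ] ℝ, ∀ ξ, G ⟨x, ξ⟩ = l ξ) :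
    ∃ Z : VField I M, G = momentum Z := by
  have h1 : ∀ x : M, ∃ z : TangentSpace I x, ∀ ξ : TangentSpace I x →L[ℝ] ℝ, G ⟨x, ξ⟩ = ξ z := by
    intro x
    obtain ⟨l, hl⟩ := hG x
    obtain ⟨f, X, h⟩ := coord_covector_eq (I := I) x
    refine ⟨∑ i, l (diff (f i) x) • X i x, fun ξ => ?_⟩
    rw [hl]
    conv_lhs => rw [h.self_of_nhds ξ, map_sum]
    simp [mul_comm]
  choose z hz using h1
  refine ⟨⟨z, fun x => ?_⟩, by ext ξ; exact hz ξ.1 ξ.2⟩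
  obtain ⟨f, -, hf, -⟩ := exists_coordinates (I := I) x
  refine hf.contMDiffAt fun j => ?_
  simp only [← hz]
  exact G.contMDiff.comp (diff (f j)).contMDiff x

end CotangentFunctions

section CotangentCoordinates

variable {E : Type*} [NormedAddCommGroup E] [NormedSpace ℝ E] [FiniteDimensional ℝ E]
  {H : Type*} [TopologicalSpace H]
  {I : ModelWithCorners ℝ E H} {M : Type*} [TopologicalSpace M] [ChartedSpace H M]
  [IsManifold I ∞ M]

theorem IsCoordinates.exists_eq_sum {ι : Type*} [Fintype ι] {F : ι → Fn I M} {x : M}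
    (hF : IsCoordinates F x) (a : TangentSpace I x →L[ℝ] ℝ) :
    ∃ c : ι → ℝ, a = ∑ j, c j • diff (F j) x := by
  classical
  let L : TangentSpace I x →ₗ[ℝ] (ι → ℝ) := LinearMap.pi fun j => (diff (F j) x).toLinearMap
  have hL : LinearMap.ker L = ⊥ := by
    refine LinearMap.ker_eq_bot'.2 fun v hv => hF.eq_zero fun j => congrFun hv j
  obtain ⟨R, hR⟩ := L.exists_leftInverse_of_injective hL
  refine ⟨fun j => a (R (Pi.single j 1)), ?_⟩
  ext v
  have h1 : v = R (L v) := (LinearMap.congr_fun hR v).symm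
  conv_lhs => rw [h1, pi_eq_sum_univ' (L v), map_sum, map_sum]
  simp [L, mul_comm]

theorem IsCoordinates.ext {ι : Type*} [Finite ι] {F : ι → Fn I M} {x : M}
    (hF : IsCoordinates F x) {u v : TangentSpace I x}
    (h : ∀ j, diff (F j) x u = diff (F j) x v) : u = v :=
  sub_eq_zero.1 (hF.eq_zero fun j => by rw [map_sub, h j, sub_self])

variable [T2Space M]

/-- Coordinates of the base and momenta of a frame express the chart of the cotangent bundle. -/
theorem exists_cotangent_coordinates (ξ₀ : Cotangent I M) :
    ∃ (f : Fin (Module.finrank ℝ E) → Fn I M) (X : Fin (Module.finrank ℝ E) → VField I M),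
      IsCoordinates (I := cotModel E I)
        (Sum.elim (fun i => basic (f i)) (fun i => momentum (X i))) ξ₀ := by
  obtain ⟨f, -, ⟨L, hL, hf⟩, -⟩ := exists_coordinates (I := I) ξ₀.1
  set b := Module.finBasis ℝ E
  obtain ⟨ψ, X, hψ, -, hX⟩ :=
    exists_frame (I := I) (V := (TangentSpace I : M → Type _)) b ξ₀.1
  refine ⟨f, X, ⟨{ toFun := fun v => Sum.elim (L v.1) (fun j => v.2 (b j)),
                   map_add' := ?_, map_smul' := ?_ }, ?_, ?_⟩⟩
  · intro v w
    ext (j | j) <;> simp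
  · intro c v
    ext (j | j) <;> simp
  · intro v w hvw
    have h1 : L v.1 = L w.1 := funext fun j => congrFun hvw (Sum.inl j)
    have h2 : v.2 = w.2 := by
      refine ContinuousLinearMap.coe_injective (b.ext fun j => ?_)
      exact congrFun hvw (Sum.inr j)
    exact Prod.ext (hL h1) h2
  · have hb := (trivializationAt E (TangentSpace I : M → Type _) ξ₀.1).open_baseSet.mem_nhds
      (FiberBundle.mem_baseSet_trivializationAt E (TangentSpace I : M → Type _) ξ₀.1)
    have hc : Filter.Tendsto (fun ξ : Cotangent I M => ξ.1) (𝓝 ξ₀) (𝓝 ξ₀.1) :=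
      (FiberBundle.continuous_proj (E →L[ℝ] ℝ)
        (fun x : M => TangentSpace I x →L[ℝ] ℝ)).continuousAt
    filter_upwards [hc.eventually (hf.and (hψ.and hb))] with ξ ⟨h1, h2,
      (h3 : ξ.1 ∈ (trivializationAt E (TangentSpace I : M → Type _) ξ₀.1).baseSet)⟩
    have h4 : extChartAt (cotModel E I) ξ₀ ξ = (extChartAt I ξ₀.1 ξ.1,
        (trivializationAt (E →L[ℝ] ℝ) (fun x : M => TangentSpace I x →L[ℝ] ℝ) ξ₀.1 ξ).2) := by
      rw [FiberBundle.extChartAt]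
      rfl
    rw [h4]
    rintro (j | j)
    · exact h1 j
    · change ξ.2 (X j ξ.1) = _
      have h5 := hX ξ.1 ((trivializationAt E (TangentSpace I : M → Type _) ξ₀.1).symm ξ.1 (b j))
      rw [h2, Trivialization.apply_mk_symm _ h3] at h5
      simp only [Pi.one_apply, one_smul, Module.Basis.repr_self, Finsupp.single_apply, ite_smul,
        zero_smul, Finset.sum_ite_eq, Finset.mem_univ, if_true] at h5
      rw [← h5]
      change _ = ContinuousLinearMap.inCoordinates E (TangentSpace I : M → Type _) ℝ
        (fun _ : M => ℝ) ξ₀.1 ξ.1 ξ₀.1 ξ.1 ξ.2 (b j)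
      simp only [ContinuousLinearMap.inCoordinates, ContinuousLinearMap.coe_comp,
        Function.comp_apply, Trivialization.symmL_apply (R := ℝ)
          (e := trivializationAt E (TangentSpace I : M → Type _) ξ₀.1) h3]
      simp

/-- Tangent vectors of the cotangent bundle are determined by the derivatives of functions of the
base and of momenta. -/
theorem tangent_ext {ξ : Cotangent I M} {u v : TangentSpace (cotModel E I) ξ}
    (hb : ∀ f : Fn I M, diff (basic f) ξ u = diff (basic f) ξ v)
    (hm : ∀ X : VField I M, diff (momentum X) ξ u = diff (momentum X) ξ v) : u = v := by
  obtain ⟨f, X, h⟩ := exists_cotangent_coordinates ξ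
  refine h.ext ?_
  rintro (j | j)
  · exact hb (f j)
  · exact hm (X j)

theorem contMDiff_of_basic_momentum {V : ∀ ξ : Cotangent I M, TangentSpace (cotModel E I) ξ}
    (hb : ∀ f : Fn I M, ContMDiff (cotModel E I) 𝓘(ℝ, ℝ) ∞ fun ξ => diff (basic f) ξ (V ξ))
    (hm : ∀ X : VField I M,
      ContMDiff (cotModel E I) 𝓘(ℝ, ℝ) ∞ fun ξ => diff (momentum X) ξ (V ξ)) :
    ContMDiff (cotModel E I) ((cotModel E I).prod 𝓘(ℝ, E × (E →L[ℝ] ℝ))) ∞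
      (fun ξ => TotalSpace.mk' (E × (E →L[ℝ] ℝ)) ξ (V ξ)) := by
  intro ξ
  obtain ⟨f, X, h⟩ := exists_cotangent_coordinates ξ
  refine h.contMDiffAt ?_
  rintro (j | j)
  · exact hb (f j) ξ
  · exact hm (X j) ξ

theorem exists_basic_add_momentum_eq (ξ : Cotangent I M)
    (a : TangentSpace (cotModel E I) ξ →L[ℝ] ℝ) :
    ∃ (f : Fn I M) (X : VField I M), diff (basic f + momentum X) ξ = a := by
  obtain ⟨f, X, h⟩ := exists_cotangent_coordinates ξ
  obtain ⟨c, hc⟩ := h.exists_eq_sum a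
  refine ⟨∑ i, c (Sum.inl i) • f i, ∑ i, c (Sum.inr i) • X i, ?_⟩
  rw [← basicHom_apply, ← momentumHom_apply, ← diffAt_apply, map_add, map_sum, map_sum, map_sum,
    map_sum, hc, Fintype.sum_sum_type]
  simp only [map_smul]
  rfl

end CotangentCoordinates

section Brackets

variable {E : Type*} [NormedAddCommGroup E] [NormedSpace ℝ E]
  {H : Type*} [TopologicalSpace H]
  {I : ModelWithCorners ℝ E H} {M : Type*} [TopologicalSpace M] [ChartedSpace H M]
  [IsManifold I ∞ M]

theorem fieldDeriv_neg (X : VField I M) (f : Fn I M) : fieldDeriv X (-f) = -fieldDeriv X f :=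
  map_neg (AddMonoidHom.mk' (fieldDeriv X) (fieldDeriv_add X)) f

theorem pairing_add_left (α β : OneForm I M) (X : VField I M) :
    pairing (α + β) X = pairing α X + pairing β X := rfl

theorem pairing_smul_left (f : Fn I M) (α : OneForm I M) (X : VField I M) :
    pairing (f • α) X = f * pairing α X := rfl

theorem pairing_neg (α : OneForm I M) (X : VField I M) : pairing α (-X) = -pairing α X :=
  map_neg (AddMonoidHom.mk' (pairing α) (pairing_add α)) X

theorem pairing_sub (α : OneForm I M) (X Y : VField I M) :
    pairing α (X - Y) = pairing α X - pairing α Y :=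
  map_sub (AddMonoidHom.mk' (pairing α) (pairing_add α)) X Y

theorem lieBracket_swap [CompleteSpace E] (X Y : VField I M) :
    lieBracket X Y = -lieBracket Y X := by
  ext x
  exact VectorField.mlieBracket_swap_apply

namespace Bivector

variable (w : Bivector I M)

theorem bracket_apply (f g : Fn I M) (x : M) :
    w.bracket f g x = diff g x (w.sharp x (diff f x)) := rfl

theorem bracket_skew (f g : Fn I M) : w.bracket f g = -w.bracket g f := by
  ext x
  exact w.skew x _ _

theorem bracket_add_right (f g h : Fn I M) :
    w.bracket f (g + h) = w.bracket f g + w.bracket f h := fieldDeriv_add _ _ _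

theorem bracket_add_left (f g h : Fn I M) :
    w.bracket (f + g) h = w.bracket f h + w.bracket g h := by
  rw [bracket_skew, bracket_add_right, w.bracket_skew f, w.bracket_skew g]
  ring

theorem bracket_neg_right (f g : Fn I M) : w.bracket f (-g) = -w.bracket f g :=
  fieldDeriv_neg _ _

theorem bracket_neg_left (f g : Fn I M) : w.bracket (-f) g = -w.bracket f g := by
  rw [bracket_skew, bracket_neg_right, w.bracket_skew f]

theorem bracket_mul_right (f g h : Fn I M) :
    w.bracket f (g * h) = g * w.bracket f h + h * w.bracket f g := fieldDeriv_mul _ _ _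

theorem bracket_apply_congr {f f' g g' : Fn I M} {x : M} (hf : diff f x = diff f' x)
    (hg : diff g x = diff g' x) : w.bracket f g x = w.bracket f' g' x := by
  rw [bracket_apply, bracket_apply, hf, hg]

/-- The cyclic sum of double brackets. -/
def jacobiator (f g h : Fn I M) : Fn I M :=
  w.bracket (w.bracket f g) h + w.bracket (w.bracket g h) f + w.bracket (w.bracket h f) g

theorem jacobiator_cyclic (f g h : Fn I M) : w.jacobiator f g h = w.jacobiator g h f := by
  simp only [jacobiator]
  ring

theorem jacobiator_add (f g h k : Fn I M) :
    w.jacobiator f g (h + k) = w.jacobiator f g h + w.jacobiator f g k := by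
  simp only [jacobiator, bracket_add_left, bracket_add_right]
  ring

theorem jacobiator_eq_fieldDeriv [CompleteSpace E] (f g h : Fn I M) :
    w.jacobiator f g h = fieldDeriv (w.sharpField (diff (w.bracket f g)) -
      lieBracket (w.sharpField (diff f)) (w.sharpField (diff g))) h := by
  have h1 : ∀ X Y : VField I M, fieldDeriv (X - Y) h = fieldDeriv X h - fieldDeriv Y h :=
    pairing_sub _
  rw [h1, fieldDeriv_lieBracket]
  change _ = w.bracket (w.bracket f g) h -
    (w.bracket f (w.bracket g h) - w.bracket g (w.bracket f h))
  rw [jacobiator, w.bracket_skew f (w.bracket g h), w.bracket_skew g (w.bracket f h),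
    w.bracket_skew h f, w.bracket_neg_left]
  ring

theorem jacobiator_apply_congr [CompleteSpace E] {f g h k : Fn I M} {x : M}
    (e : diff h x = diff k x) : w.jacobiator f g h x = w.jacobiator f g k x := by
  rw [jacobiator_eq_fieldDeriv, jacobiator_eq_fieldDeriv]
  exact congrArg (fun a : TangentSpace I x →L[ℝ] ℝ => a _) e

/-- The Jacobi identity may be tested on functions whose differentials exhaust all covectors. -/
theorem isPoisson_of_forall_mem [CompleteSpace E] (S : Set (Fn I M))
    (hS : ∀ (x : M) (a : TangentSpace I x →L[ℝ] ℝ), ∃ f ∈ S, diff f x = a)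
    (h : ∀ f ∈ S, ∀ g ∈ S, ∀ k ∈ S, w.jacobiator f g k = 0) : w.IsPoisson := by
  intro f g k
  ext x
  obtain ⟨f', hf, ef⟩ := hS x (diff f x)
  obtain ⟨g', hg, eg⟩ := hS x (diff g x)
  obtain ⟨k', hk, ek⟩ := hS x (diff k x)
  change w.jacobiator f g k x = 0
  rw [w.jacobiator_apply_congr ek.symm, jacobiator_cyclic, w.jacobiator_apply_congr ef.symm,
    jacobiator_cyclic, w.jacobiator_apply_congr eg.symm, jacobiator_cyclic, h f' hf g' hg k' hk]
  rfl

end Bivector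

variable [FiniteDimensional ℝ E] [T2Space M]

theorem OneForm.ext_pairing {α β : OneForm I M} (h : ∀ X, pairing α X = pairing β X) : α = β := by
  ext x v
  have := congrArg (fun f : Fn I M => f x) (h (extField x v))
  simpa [extField_apply] using this

theorem vector_ext {x : M} {u v : TangentSpace I x} (h : ∀ f : Fn I M, diff f x u = diff f x v) :
    u = v := by
  obtain ⟨f, -, hf, -⟩ := exists_coordinates (I := I) x
  exact hf.ext fun j => h (f j)

namespace Bivector

variable (w : Bivector I M)

theorem formBracket_diff (f g : Fn I M) :
    w.formBracket (diff f) (diff g) = diff (w.bracket f g) := by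
  have : CompleteSpace E := FiniteDimensional.complete ℝ E
  refine OneForm.ext_pairing fun Y => ?_
  rw [formBracket, pairing_ofTensorial]
  have h1 : ∀ (X : VField I M) (h : Fn I M), pairing (diff h) X = fieldDeriv X h := fun _ _ => rfl
  simp only [h1, fieldDeriv_lieBracket]
  have h2 : ∀ h k : Fn I M, fieldDeriv (w.sharpField (diff h)) k = w.bracket h k := fun _ _ => rfl
  simp only [h2]
  rw [w.bracket_skew g f, fieldDeriv_neg]
  ring

theorem pairing_formBracket [CompleteSpace E] (α β : OneForm I M) (Y : VField I M) :
    pairing (w.formBracket α β) Y =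
      (fieldDeriv (w.sharpField α) (pairing β Y) - pairing β (lieBracket (w.sharpField α) Y))
      - (fieldDeriv (w.sharpField β) (pairing α Y) - pairing α (lieBracket (w.sharpField β) Y))
      - fieldDeriv Y (pairing β (w.sharpField α)) := by
  rw [formBracket, pairing_ofTensorial]

theorem pairing_sharpField_swap (α β : OneForm I M) :
    pairing β (w.sharpField α) = -pairing α (w.sharpField β) := by
  ext x
  exact w.skew x _ _

theorem sharpField_add (α β : OneForm I M) :
    w.sharpField (α + β) = w.sharpField α + w.sharpField β := by
  ext x
  exact map_add (w.sharp x) _ _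

theorem sharpField_smul (f : Fn I M) (α : OneForm I M) :
    w.sharpField (f • α) = f • w.sharpField α := by
  ext x
  exact map_smul (w.sharp x) _ _

theorem formBracket_skew (α β : OneForm I M) :
    w.formBracket α β = -w.formBracket β α := by
  have : CompleteSpace E := FiniteDimensional.complete ℝ E
  refine OneForm.ext_pairing fun Y => ?_
  have h : pairing (-w.formBracket β α) Y = -pairing (w.formBracket β α) Y := rfl
  rw [h, pairing_formBracket, pairing_formBracket, pairing_sharpField_swap, fieldDeriv_neg]
  ring

theorem formBracket_add_left (α α' β : OneForm I M) :
    w.formBracket (α + α') β = w.formBracket α β + w.formBracket α' β := by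
  have : CompleteSpace E := FiniteDimensional.complete ℝ E
  refine OneForm.ext_pairing fun Y => ?_
  rw [pairing_add_left]
  simp only [pairing_formBracket, sharpField_add, fieldDeriv_add_left, pairing_add_left,
    fieldDeriv_add, pairing_add, lieBracket_swap _ Y, lieBracket_add, pairing_neg]
  ring

theorem formBracket_smul_left (f : Fn I M) (α β : OneForm I M) :
    w.formBracket (f • α) β = f • w.formBracket α β - fieldDeriv (w.sharpField β) f • α := by
  have : CompleteSpace E := FiniteDimensional.complete ℝ E
  refine OneForm.ext_pairing fun Y => ?_
  have h : ∀ γ δ : OneForm I M, pairing (γ - δ) Y = pairing γ Y - pairing δ Y := fun _ _ => rfl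
  rw [h]
  simp only [pairing_smul_left, pairing_formBracket, sharpField_smul, fieldDeriv_smul_left,
    fieldDeriv_mul, pairing_add, pairing_smul, lieBracket_swap _ Y, lieBracket_smul, pairing_neg]
  ring

end Bivector

namespace ContravariantConnection

variable {w : Bivector I M} (D : ContravariantConnection w)

theorem neg_left (α : OneForm I M) (X : VField I M) : D.D (-α) X = -D.D α X :=
  map_neg (AddMonoidHom.mk' (fun α => D.D α X) fun α β => D.add_left α β X) α

theorem sub_left (α β : OneForm I M) (X : VField I M) : D.D (α - β) X = D.D α X - D.D β X :=
  map_sub (AddMonoidHom.mk' (fun α => D.D α X) fun α β => D.add_left α β X) α β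

/-- The value of `D_α X` at a point only depends on the value of `α` there. -/
theorem apply_congr {α β : OneForm I M} {x : M} (h : α x = β x) (X : VField I M) :
    D.D α X x = D.D β X x := by
  refine vector_ext fun f => ?_
  refine apply_eq_of_eq (φ := fun γ : OneForm I M => pairing (diff f) (D.D γ X)) ?_ ?_ h
  · intro γ δ
    rw [D.add_left, pairing_add]
  · intro g γ
    rw [D.smul_left, pairing_smul]

/-- The curvature. -/
def curvature (α β : OneForm I M) (X : VField I M) : VField I M :=
  D.D α (D.D β X) - D.D β (D.D α X) - D.D (w.formBracket α β) X

theorem curvature_skew (α β : OneForm I M) (X : VField I M) :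
    D.curvature α β X = -D.curvature β α X := by
  rw [curvature, curvature, w.formBracket_skew, D.neg_left]
  abel

theorem curvature_add_left (α α' β : OneForm I M) (X : VField I M) :
    D.curvature (α + α') β X = D.curvature α β X + D.curvature α' β X := by
  simp only [curvature, w.formBracket_add_left, D.add_left, D.add_right]
  abel

theorem curvature_smul_left (f : Fn I M) (α β : OneForm I M) (X : VField I M) :
    D.curvature (f • α) β X = f • D.curvature α β X := by
  simp only [curvature, w.formBracket_smul_left, D.sub_left, D.smul_left, D.leibniz]
  ext x
  simp only [ContMDiffSection.coe_sub, ContMDiffSection.coe_add, Pi.sub_apply, Pi.add_apply,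
    smul_section_apply]
  module

theorem curvature_apply_congr {α α' : OneForm I M} {x : M} (h : α x = α' x) (β : OneForm I M)
    (X : VField I M) : D.curvature α β X x = D.curvature α' β X x := by
  refine vector_ext fun f => ?_
  refine apply_eq_of_eq (φ := fun γ : OneForm I M => pairing (diff f) (D.curvature γ β X)) ?_ ?_ h
  · intro γ δ
    rw [D.curvature_add_left, pairing_add]
  · intro g γ
    rw [D.curvature_smul_left, pairing_smul]

/-- Flatness may be tested on exact forms. -/
theorem isFlat_of_diff (h : ∀ f g X, D.curvature (diff f) (diff g) X = 0) : D.IsFlat := by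
  intro α β X
  change D.curvature α β X = 0
  ext x
  obtain ⟨f, hf⟩ := exists_diff_eq x (α x)
  obtain ⟨g, hg⟩ := exists_diff_eq x (β x)
  rw [D.curvature_apply_congr hf.symm, D.curvature_skew]
  change -(D.curvature β (diff f) X x) = 0
  rw [D.curvature_apply_congr hg.symm, h]
  simp

theorem pairing_formDeriv (α β : OneForm I M) (X : VField I M) :
    pairing (D.formDeriv α β) X =
      fieldDeriv (w.sharpField α) (pairing β X) - pairing β (D.D α X) := by
  rw [formDeriv, pairing_ofTensorial]

theorem formDeriv_add (α β γ : OneForm I M) :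
    D.formDeriv α (β + γ) = D.formDeriv α β + D.formDeriv α γ := by
  refine OneForm.ext_pairing fun X => ?_
  simp only [pairing_add_left, pairing_formDeriv, fieldDeriv_add]
  ring

end ContravariantConnection

namespace SymTensor

variable (G : SymTensor I M 2)

theorem form_swap {x : M} (a b : TangentSpace I x →L[ℝ] ℝ) :
    G.form x ![a, b] = G.form x ![b, a] := by
  rw [← G.symm x (Equiv.swap 0 1)]
  congr 1
  ext i : 1
  fin_cases i <;> simp

theorem form_add_left {x : M} (a a' b : TangentSpace I x →L[ℝ] ℝ) :
    G.form x ![a + a', b] = G.form x ![a, b] + G.form x ![a', b] :=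
  (G.form x).cons_add ![b] a a'

theorem form_add_right {x : M} (a b b' : TangentSpace I x →L[ℝ] ℝ) :
    G.form x ![a, b + b'] = G.form x ![a, b] + G.form x ![a, b'] := by
  rw [form_swap, form_add_left, form_swap, G.form_swap b']

theorem form_smul_left {x : M} (c : ℝ) (a b : TangentSpace I x →L[ℝ] ℝ) :
    G.form x ![c • a, b] = c * G.form x ![a, b] :=
  (G.form x).cons_smul ![b] c a

theorem form_smul_right {x : M} (c : ℝ) (a b : TangentSpace I x →L[ℝ] ℝ) :
    G.form x ![a, c • b] = c * G.form x ![a, b] := by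
  rw [form_swap, form_smul_left, form_swap]

theorem form_diag {x : M} (a : TangentSpace I x →L[ℝ] ℝ) :
    G.form x (fun _ => a) = G.form x ![a, a] := by
  congr 1
  ext i : 1
  fin_cases i <;> rfl

theorem eval_two_apply (α : Fin 2 → OneForm I M) (x : M) :
    G.eval α x = G.form x ![α 0 x, α 1 x] := by
  change G.form x (fun i => α i x) = _
  congr 1
  ext i : 1
  fin_cases i <;> rfl

theorem eval_add_left (α α' β : OneForm I M) :
    G.eval ![α + α', β] = G.eval ![α, β] + G.eval ![α', β] := by
  ext x
  simp only [eval_two_apply, ContMDiffMap.coe_add, Pi.add_apply]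
  exact G.form_add_left _ _ _

theorem eval_swap (α β : OneForm I M) : G.eval ![α, β] = G.eval ![β, α] := by
  ext x
  simp only [eval_two_apply]
  exact G.form_swap _ _

theorem eval_add_right (α β β' : OneForm I M) :
    G.eval ![α, β + β'] = G.eval ![α, β] + G.eval ![α, β'] := by
  rw [eval_swap, eval_add_left, eval_swap, G.eval_swap β']

end SymTensor

theorem ContravariantConnection.tensorDeriv_two {w : Bivector I M} (D : ContravariantConnection w)
    (α : OneForm I M) (G : SymTensor I M 2) (β γ : OneForm I M) :
    D.tensorDeriv α G ![β, γ] = fieldDeriv (w.sharpField α) (G.eval ![β, γ]) -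
      (G.eval ![D.formDeriv α β, γ] + G.eval ![β, D.formDeriv α γ]) := by
  rw [tensorDeriv, Fin.sum_univ_two]
  congr 4 <;> ext i : 1 <;> fin_cases i <;> rfl

/-- Polarization: a parallel tensor equation in degree two may be tested on the diagonal. -/
theorem tensorDeriv_eq_of_diag {w : Bivector I M} (D : ContravariantConnection w)
    (α : OneForm I M) (G R : SymTensor I M 2)
    (h : ∀ β, D.tensorDeriv α G ![β, β] = R.eval ![β, β]) (β γ : OneForm I M) :
    D.tensorDeriv α G ![β, γ] = R.eval ![β, γ] := by
  have h1 := h (β + γ)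
  have h2 := h β
  have h3 := h γ
  simp only [D.tensorDeriv_two, D.formDeriv_add, SymTensor.eval_add_left, SymTensor.eval_add_right,
    fieldDeriv_add] at h1 h2 h3 ⊢
  rw [G.eval_swap γ β, G.eval_swap (D.formDeriv α γ) β, G.eval_swap γ (D.formDeriv α β),
    R.eval_swap γ β] at h1
  ext x
  have e1 := congrArg (fun f : Fn I M => f x) h1
  have e2 := congrArg (fun f : Fn I M => f x) h2
  have e3 := congrArg (fun f : Fn I M => f x) h3
  simp only [ContMDiffMap.coe_add, ContMDiffMap.coe_sub, Pi.add_apply, Pi.sub_apply] at e1 e2 e3 ⊢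
  linarith

end Brackets

section Vertical

variable {E : Type*} [NormedAddCommGroup E] [NormedSpace ℝ E]
  {H : Type*} [TopologicalSpace H]
  {I : ModelWithCorners ℝ E H} {M : Type*} [TopologicalSpace M] [ChartedSpace H M]
  [IsManifold I ∞ M]

theorem diff_apply_add (f : Fn I M) {x : M} (u v : TangentSpace I x) :
    diff f x (u + v) = diff f x u + diff f x v := map_add (diff f x) u v

/-- The affine line through `ξ` in the direction `η` in a fibre of the cotangent bundle. -/
def fibreLine {x : M} (ξ η : TangentSpace I x →L[ℝ] ℝ) :
    C^∞⟮𝓘(ℝ, ℝ), ℝ; cotModel E I, Cotangent I M⟯ where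
  val t := ⟨x, ξ + t • η⟩
  property := by
    intro t
    rw [contMDiffAt_hom_bundle]
    refine ⟨contMDiffAt_const, ?_⟩
    have h : ∀ s : ℝ, ContinuousLinearMap.inCoordinates E (TangentSpace I : M → Type _) ℝ
        (fun _ : M => ℝ) x x x x (ξ + s • η) =
        ContinuousLinearMap.inCoordinates E (TangentSpace I : M → Type _) ℝ
          (fun _ : M => ℝ) x x x x ξ + s • ContinuousLinearMap.inCoordinates E
            (TangentSpace I : M → Type _) ℝ (fun _ : M => ℝ) x x x x η := by
      intro s
      ext v
      simp [ContinuousLinearMap.inCoordinates]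
    simp only [h]
    exact contMDiffAt_const.add (contMDiffAt_id.smul contMDiffAt_const)

/-- A covector, seen as a vertical tangent vector of the cotangent bundle. -/
theorem exists_vertical {x : M} (ξ η : TangentSpace I x →L[ℝ] ℝ) :
    ∃ u : TangentSpace (cotModel E I) (⟨x, ξ⟩ : Cotangent I M),
      ∀ P : Fn (cotModel E I) (Cotangent I M),
        diff P ⟨x, ξ⟩ u = deriv (fun t : ℝ => P ⟨x, ξ + t • η⟩) 0 := by
  set c := fibreLine ξ η
  have h0 : (⟨x, ξ⟩ : Cotangent I M) = c 0 := by
    refine Eq.symm ?_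
    change (⟨x, ξ + (0 : ℝ) • η⟩ : Cotangent I M) = _
    rw [zero_smul, add_zero]
  suffices H : ∀ ζ : Cotangent I M, ζ = c 0 → ∃ u : TangentSpace (cotModel E I) ζ,
      ∀ P : Fn (cotModel E I) (Cotangent I M), diff P ζ u = deriv (fun t : ℝ => P (c t)) 0 from
    H _ h0
  rintro _ rfl
  refine ⟨mfderiv 𝓘(ℝ, ℝ) (cotModel E I) c 0 (1 : ℝ), fun P => ?_⟩
  have h1 := congrArg (fun a : ℝ →L[ℝ] ℝ => a 1) (diff_comp P c 0)
  refine h1.symm.trans ?_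
  change mfderiv 𝓘(ℝ, ℝ) 𝓘(ℝ, ℝ) (fun t : ℝ => P (c t)) 0 (1 : ℝ) = _
  rw [mfderiv_eq_fderiv]
  rfl

end Vertical

section Induced

variable {E : Type*} [NormedAddCommGroup E] [NormedSpace ℝ E] [FiniteDimensional ℝ E]
  {H : Type*} [TopologicalSpace H]
  {I : ModelWithCorners ℝ E H} {M : Type*} [TopologicalSpace M] [ChartedSpace H M] [T2Space M]
  [IsManifold I ∞ M] {W : Bivector (cotModel E I) (Cotangent I M)}

/-- One-forms as smooth maps to the cotangent bundle. -/
def OneForm.toMap (β : OneForm I M) : C^∞⟮I, M; cotModel E I, Cotangent I M⟯ :=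
  ⟨fun x => ⟨x, β x⟩, β.contMDiff⟩

/-- The bracket with `f ∘ π` is the derivative along `df` on quadratic functions. -/
theorem bracket_basic_poly {w : Bivector I M} (D : ContravariantConnection w) {f : Fn I M}
    (hb : ∀ g, W.bracket (basic f) (basic g) = basic (w.bracket f g))
    (hm : ∀ X, W.bracket (basic f) (momentum X) = momentum (D.D (diff f) X))
    (G : SymTensor I M 2) (β : OneForm I M) (x : M) :
    W.bracket (basic f) (poly G) ⟨x, β x⟩ = D.tensorDeriv (diff f) G ![β, β] x := by
  let ξ : Cotangent I M := ⟨x, β x⟩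
  set γ := D.formDeriv (diff f) β
  let u₁ : TangentSpace (cotModel E I) ξ :=
    mfderiv I (cotModel E I) (OneForm.toMap β) x (w.sharp x (diff f x))
  obtain ⟨u₂, hu₂⟩ : ∃ u : TangentSpace (cotModel E I) ξ, ∀ P : Fn (cotModel E I) (Cotangent I M),
      diff P ξ u = deriv (fun t : ℝ => P ⟨x, β x + t • -γ x⟩) 0 := exists_vertical (β x) (-γ x)
  have hu₁ : ∀ P : Fn (cotModel E I) (Cotangent I M),
      diff P ξ u₁ = fieldDeriv (w.sharpField (diff f)) (P.comp (OneForm.toMap β)) x := by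
    intro P
    exact (congrArg (fun a : TangentSpace I x →L[ℝ] ℝ => a (w.sharp x (diff f x)))
      (diff_comp P (OneForm.toMap β) x)).symm
  have hv : W.sharp ξ (diff (basic f) ξ) = u₁ + u₂ := by
    refine tangent_ext (fun g => ?_) fun X => ?_
    · rw [← W.bracket_apply, hb, diff_apply_add, hu₁, hu₂]
      change w.bracket f g x = w.bracket f g x + deriv (fun _ : ℝ => g x) 0
      simp
    · rw [← W.bracket_apply, hm, diff_apply_add, hu₁, hu₂]
      have h1 := congrArg (fun h : Fn I M => h x) (D.pairing_formDeriv (diff f) β X)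
      have h2 : HasDerivAt (fun t : ℝ => β x (X x) + t * -(γ x (X x))) (1 * -(γ x (X x))) 0 :=
        ((hasDerivAt_id (0 : ℝ)).mul_const _).const_add _
      have h3 : deriv (fun t : ℝ => momentum X ⟨x, β x + t • -γ x⟩) 0 = -(γ x (X x)) := by
        rw [← one_mul (-(γ x (X x))), ← h2.deriv]
        rfl
      rw [h3]
      change β x (D.D (diff f) X x) =
        fieldDeriv (w.sharpField (diff f)) (pairing β X) x - γ x (X x)
      change γ x (X x) = fieldDeriv (w.sharpField (diff f)) (pairing β X) x -
        β x (D.D (diff f) X x) at h1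
      rw [h1]
      ring
  change W.bracket (basic f) (poly G) ξ = _
  rw [W.bracket_apply, hv, diff_apply_add, hu₁, hu₂, D.tensorDeriv_two]
  have h1 : (poly G).comp (OneForm.toMap β) = G.eval ![β, β] := by
    ext y
    rw [G.eval_two_apply]
    exact G.form_diag _
  have h2 : (fun t : ℝ => poly G ⟨x, β x + t • -γ x⟩) = fun t : ℝ =>
      G.form x ![β x, β x] + t * -(G.form x ![γ x, β x] + G.form x ![β x, γ x]) +
        t * (t * G.form x ![γ x, γ x]) := by
    funext t
    rw [poly_apply]
    refine (G.form_diag (x := x) (β x + t • -γ x)).trans ?_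
    rw [← neg_one_smul ℝ (γ x)]
    simp only [SymTensor.form_add_left, SymTensor.form_add_right, SymTensor.form_smul_left,
      SymTensor.form_smul_right]
    ring
  have h3 : HasDerivAt (fun t : ℝ =>
      G.form x ![β x, β x] + t * -(G.form x ![γ x, β x] + G.form x ![β x, γ x]) +
        t * (t * G.form x ![γ x, γ x]))
      (1 * -(G.form x ![γ x, β x] + G.form x ![β x, γ x]) +
        (1 * ((0 : ℝ) * G.form x ![γ x, γ x]) + 0 * (1 * G.form x ![γ x, γ x]))) 0 :=
    (((hasDerivAt_id (0 : ℝ)).mul_const _).const_add _).add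
      ((hasDerivAt_id (0 : ℝ)).mul ((hasDerivAt_id (0 : ℝ)).mul_const _))
  rw [h1, h2, h3.deriv]
  simp only [ContMDiffMap.coe_add, ContMDiffMap.coe_sub, Pi.add_apply, Pi.sub_apply,
    SymTensor.eval_two_apply]
  simp only [Matrix.cons_val_zero, Matrix.cons_val_one]
  ring

namespace Induces

variable {d : BaseData I M} (hd : Induces W d)
include hd

theorem basic_momentum (f : Fn I M) (X : VField I M) :
    W.bracket (basic f) (momentum X) = momentum (d.D.D (diff f) X) := by
  rw [W.bracket_skew, hd.momentum_basic, neg_neg]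

theorem jacobiator_basic (f g h : Fn I M) :
    W.jacobiator (basic f) (basic g) (basic h) = basic (d.w.jacobiator f g h) := by
  simp only [Bivector.jacobiator, hd.basic_basic, basic_add]

theorem jacobiator_momentum_basic (X : VField I M) (f g : Fn I M) :
    W.jacobiator (momentum X) (basic f) (basic g) =
      -momentum (d.D.curvature (diff f) (diff g) X) := by
  simp only [Bivector.jacobiator, hd.basic_basic, hd.momentum_basic, hd.basic_momentum,
    W.bracket_neg_left, ContravariantConnection.curvature, momentum_sub,
    Bivector.formBracket_diff]
  ring

theorem jacobiator_momentum_momentum_basic (X Y : VField I M) (f : Fn I M) :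
    W.jacobiator (momentum X) (momentum Y) (basic f) =
      poly (d.P.Ψ (d.D.D (diff f) X) Y) + poly (d.P.Ψ X (d.D.D (diff f) Y)) -
        W.bracket (basic f) (poly (d.P.Ψ X Y)) := by
  simp only [Bivector.jacobiator, hd.momentum_basic, hd.basic_momentum, W.bracket_neg_left,
    hd.momentum_momentum]
  rw [W.bracket_skew _ (basic f), d.P.skew X]
  have h : ∀ G : SymTensor I M 2, poly (-G) = -poly G := fun _ => rfl
  rw [h]
  ring

theorem jacobiator_momentum (X Y Z : VField I M) :
    W.jacobiator (momentum X) (momentum Y) (momentum Z) =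
      poly (d.Θ (d.P.Ψ X Y) Z + d.Θ (d.P.Ψ Y Z) X + d.Θ (d.P.Ψ Z X) Y) := by
  simp only [Bivector.jacobiator, hd.momentum_momentum, hd.quadratic_momentum]
  rfl

theorem bracket_basic_poly_eq_iff (f : Fn I M) (X Y : VField I M) :
    W.bracket (basic f) (poly (d.P.Ψ X Y)) =
      poly (d.P.Ψ (d.D.D (diff f) X) Y) + poly (d.P.Ψ X (d.D.D (diff f) Y)) ↔
    ∀ β : Fin 2 → OneForm I M, d.D.tensorDeriv (diff f) (d.P.Ψ X Y) β
      - (d.P.Ψ (d.D.D (diff f) X) Y).eval β - (d.P.Ψ X (d.D.D (diff f) Y)).eval β = 0 := by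
  have key := fun β x => bracket_basic_poly d.D (hd.basic_basic f) (hd.basic_momentum f)
    (d.P.Ψ X Y) β x
  have hβ : ∀ β : Fin 2 → OneForm I M, β = ![β 0, β 1] := fun β => by
    ext i : 1
    fin_cases i <;> rfl
  set R := d.P.Ψ (d.D.D (diff f) X) Y + d.P.Ψ X (d.D.D (diff f) Y)
  have hR : ∀ β, R.eval β = (d.P.Ψ (d.D.D (diff f) X) Y).eval β +
    (d.P.Ψ X (d.D.D (diff f) Y)).eval β := fun _ => rfl
  constructor
  · intro h β
    rw [sub_sub, sub_eq_zero, ← hR, hβ β]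
    refine tensorDeriv_eq_of_diag _ _ _ _ (fun β => ?_) _ _
    ext x
    rw [← key, h, R.eval_two_apply]
    exact R.form_diag _
  · intro h
    ext ξ
    obtain ⟨β, hβξ⟩ := exists_section_eq (I := I) (F := E →L[ℝ] ℝ)
      (V := fun x : M => TangentSpace I x →L[ℝ] ℝ) ξ.1 ξ.2
    have h1 := key β ξ.1
    rw [hβξ] at h1
    have h2 := h ![β, β]
    rw [sub_sub, sub_eq_zero, ← hR] at h2
    refine h1.trans ?_
    rw [h2, R.eval_two_apply]
    change R.form ξ.1 ![β ξ.1, β ξ.1] = _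
    rw [hβξ, ← R.form_diag]
    rfl

theorem isIntegrable (hW : W.IsPoisson) : d.IsIntegrable where
  poisson f g h := by
    apply basic_injective
    exact (hd.jacobiator_basic f g h).symm.trans (hW _ _ _)
  flat := by
    refine d.D.isFlat_of_diff fun f g X => momentum_injective ?_
    rw [← neg_inj, ← hd.jacobiator_momentum_basic]
    refine (hW _ _ _).trans ?_
    rw [← momentumHom_apply, map_zero, neg_zero]
  parallel f X Y := by
    refine (hd.bracket_basic_poly_eq_iff f X Y).1 ?_
    rw [← sub_eq_zero, ← neg_eq_zero, neg_sub, ← hd.jacobiator_momentum_momentum_basic]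
    exact hW _ _ _
  cyclic X Y Z := poly_injective ((hd.jacobiator_momentum X Y Z).symm.trans (hW _ _ _))

theorem isPoisson (h : d.IsIntegrable) : W.IsPoisson := by
  have : CompleteSpace E := FiniteDimensional.complete ℝ E
  have : CompleteSpace (E →L[ℝ] ℝ) := FiniteDimensional.complete ℝ _
  have hbbb : ∀ f g k, W.jacobiator (basic f) (basic g) (basic k) = 0 := fun f g k => by
    rw [hd.jacobiator_basic]
    exact congrArg basic (h.poisson f g k)
  have hmbb : ∀ X f g, W.jacobiator (momentum X) (basic f) (basic g) = 0 := fun X f g => by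
    have : d.D.curvature (diff f) (diff g) X = 0 := h.flat _ _ _
    rw [hd.jacobiator_momentum_basic, this, ← momentumHom_apply, map_zero, neg_zero]
  have hmmb : ∀ X Y f, W.jacobiator (momentum X) (momentum Y) (basic f) = 0 := fun X Y f => by
    rw [hd.jacobiator_momentum_momentum_basic,
      (hd.bracket_basic_poly_eq_iff f X Y).2 (h.parallel f X Y), sub_self]
  have hmmm : ∀ X Y Z, W.jacobiator (momentum X) (momentum Y) (momentum Z) = 0 := fun X Y Z => by
    rw [hd.jacobiator_momentum, h.cyclic]
    rfl
  have add2 : ∀ F G K L, W.jacobiator F (G + L) K = W.jacobiator F G K + W.jacobiator F L K := by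
    intro F G K L
    rw [← W.jacobiator_cyclic, W.jacobiator_add, W.jacobiator_cyclic, W.jacobiator_cyclic K F L]
  have add1 : ∀ F G K L, W.jacobiator (F + L) G K = W.jacobiator F G K + W.jacobiator L G K := by
    intro F G K L
    rw [W.jacobiator_cyclic, W.jacobiator_add, ← W.jacobiator_cyclic, ← W.jacobiator_cyclic L]
  refine W.isPoisson_of_forall_mem {F | ∃ f X, F = basic f + momentum X} ?_ ?_
  · intro ξ a
    obtain ⟨f, X, hfX⟩ := exists_basic_add_momentum_eq ξ a
    exact ⟨_, ⟨f, X, rfl⟩, hfX⟩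
  · rintro _ ⟨f, X, rfl⟩ _ ⟨g, Y, rfl⟩ _ ⟨k, Z, rfl⟩
    simp only [add1, add2, W.jacobiator_add]
    rw [W.jacobiator_cyclic (basic f) (basic g) (momentum Z),
      W.jacobiator_cyclic (basic g) (momentum Z) (basic f),
      W.jacobiator_cyclic (basic f) (momentum Y) (basic k),
      W.jacobiator_cyclic (basic f) (momentum Y) (momentum Z),
      ← W.jacobiator_cyclic (momentum Z) (momentum X) (basic g)]
    simp only [hbbb, hmbb, hmmb, hmmm, add_zero]

end Induces

end Induced

section Smoothness

variable {E : Type*} [NormedAddCommGroup E] [NormedSpace ℝ E]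
  {H : Type*} [TopologicalSpace H]
  {I : ModelWithCorners ℝ E H} {M : Type*} [TopologicalSpace M] [ChartedSpace H M]
  [IsManifold I ∞ M]

/-- Smoothness of a skew-symmetric bundle map may be tested on a set of functions which detects
the smoothness of vector fields. -/
theorem contMDiff_sharp (S : Set (Fn I M))
    (hS : ∀ V : ∀ x : M, TangentSpace I x,
      (∀ f ∈ S, ContMDiff I 𝓘(ℝ, ℝ) ∞ fun x => diff f x (V x)) →
        ContMDiff I (I.prod 𝓘(ℝ, E)) ∞ fun x => TotalSpace.mk' E x (V x))
    {sharp : ∀ x : M, (TangentSpace I x →L[ℝ] ℝ) →ₗ[ℝ] TangentSpace I x}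
    (skew : ∀ x (α β : TangentSpace I x →L[ℝ] ℝ), β (sharp x α) = -α (sharp x β))
    (h : ∀ f ∈ S, ∀ g ∈ S, ContMDiff I 𝓘(ℝ, ℝ) ∞ fun x => diff g x (sharp x (diff f x)))
    (α : OneForm I M) :
    ContMDiff I (I.prod 𝓘(ℝ, E)) ∞ fun x => TotalSpace.mk' E x (sharp x (α x)) := by
  refine hS _ fun f hf => ?_
  let X : VField I M := ⟨fun x => sharp x (diff f x), hS _ (h f hf)⟩
  simp only [skew _ (α _)]
  exact (pairing α X).contMDiff.neg

theorem contMDiff_of_forall_diff [FiniteDimensional ℝ E] [T2Space M]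
    {V : ∀ x : M, TangentSpace I x}
    (h : ∀ f : Fn I M, ContMDiff I 𝓘(ℝ, ℝ) ∞ fun x => diff f x (V x)) :
    ContMDiff I (I.prod 𝓘(ℝ, E)) ∞ fun x => TotalSpace.mk' E x (V x) := by
  intro x
  obtain ⟨f, -, hf, -⟩ := exists_coordinates (I := I) x
  exact hf.contMDiffAt fun j => h (f j) x

end Smoothness

section LowDegree

variable {E : Type*} [NormedAddCommGroup E] [NormedSpace ℝ E] [FiniteDimensional ℝ E]
  {H : Type*} [TopologicalSpace H]
  {I : ModelWithCorners ℝ E H} {M : Type*} [TopologicalSpace M] [ChartedSpace H M] [T2Space M]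
  [IsManifold I ∞ M]

theorem exists_poly_eq_basic (f : Fn I M) : ∃ Q : SymTensor I M 0, poly Q = basic f :=
  ⟨⟨fun x => MultilinearMap.constOfIsEmpty ℝ _ (f x), fun _ _ _ => rfl, fun _ => f.contMDiff⟩, rfl⟩

theorem exists_poly_eq_momentum (X : VField I M) : ∃ Q : SymTensor I M 1, poly Q = momentum X := by
  obtain ⟨P, hP⟩ := exists_poly_eq (k := 1) (momentum X) fun x =>
    ⟨MultilinearMap.ofSubsingleton ℝ (TangentSpace I x →L[ℝ] ℝ) ℝ (0 : Fin 1)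
      { toFun := fun ξ => ξ (X x), map_add' := fun _ _ => rfl, map_smul' := fun _ _ => rfl },
      fun _ => rfl⟩
  exact ⟨P, hP.symm⟩

theorem exists_basic_eq_poly (Q : SymTensor I M 0) : ∃ f : Fn I M, poly Q = basic f := by
  refine ⟨Q.eval 0, ?_⟩
  ext ξ
  change Q.form ξ.1 _ = Q.form ξ.1 _
  congr 1
  ext i : 1
  exact i.elim0

theorem exists_momentum_eq_poly (Q : SymTensor I M 1) : ∃ X : VField I M, poly Q = momentum X :=
  exists_momentum_eq _ fun x =>
    ⟨(MultilinearMap.ofSubsingleton ℝ (TangentSpace I x →L[ℝ] ℝ) ℝ (0 : Fin 1)).symm (Q.form x),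
      fun _ => rfl⟩

theorem poly_symProd (X Y : VField I M) : poly (symProd X Y) = momentum X * momentum Y := by
  ext ξ
  change (1 / 2) * (ξ.2 (X ξ.1) * ξ.2 (Y ξ.1) + ξ.2 (Y ξ.1) * ξ.2 (X ξ.1)) =
    ξ.2 (X ξ.1) * ξ.2 (Y ξ.1)
  ring

theorem poly_add {k : ℕ} (Q R : SymTensor I M k) : poly (Q + R) = poly Q + poly R := rfl

theorem poly_neg {k : ℕ} (Q : SymTensor I M k) : poly (-Q) = -poly Q := rfl

theorem poly_sub {k : ℕ} (Q R : SymTensor I M k) : poly (Q - R) = poly Q - poly R := rfl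

theorem poly_smul {k : ℕ} (f : Fn I M) (Q : SymTensor I M k) :
    poly (f • Q) = basic f * poly Q := rfl

end LowDegree

section FromGraded

variable {E : Type*} [NormedAddCommGroup E] [NormedSpace ℝ E] [FiniteDimensional ℝ E]
  {H : Type*} [TopologicalSpace H]
  {I : ModelWithCorners ℝ E H} {M : Type*} [TopologicalSpace M] [ChartedSpace H M] [T2Space M]
  [IsManifold I ∞ M] {W : Bivector (cotModel E I) (Cotangent I M)}

/-- The function on the cotangent bundle that defines `D_α X`. -/
def connectionFn (W : Bivector (cotModel E I) (Cotangent I M)) (α : OneForm I M) (X : VField I M) :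
    Fn (cotModel E I) (Cotangent I M) where
  val ξ := -(α ξ.1 (mfderiv (cotModel E I) I TotalSpace.proj ξ (W.sharp ξ (diff (momentum X) ξ))))
  property := by
    refine ContMDiff.neg (contMDiff_of_trivial (I := I) (b := fun ξ : Cotangent I M => ξ.1) ?_)
    refine ContMDiff.clm_bundle_apply (F₁ := E) (E₁ := (TangentSpace I : M → Type _)) (F₂ := ℝ)
      (E₂ := fun _ : M => ℝ) (b := fun ξ : Cotangent I M => ξ.1)
      (ϕ := fun ξ : Cotangent I M => α ξ.1)
      (v := fun ξ => mfderiv (cotModel E I) I TotalSpace.proj ξ (W.sharp ξ (diff (momentum X) ξ)))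
      (α.contMDiff.comp (contMDiff_proj _)) ?_
    have h1 : ContMDiff (cotModel E I).tangent I.tangent ∞ (tangentMap (cotModel E I) I
        (TotalSpace.proj : Cotangent I M → M)) :=
      (contMDiff_proj (fun x : M => TangentSpace I x →L[ℝ] ℝ)).contMDiff_tangentMap (n := ∞)
        (by simp)
    exact h1.comp (W.sharpField (diff (momentum X))).contMDiff

namespace IsGraded

variable (hW : IsGraded W)
include hW

theorem exists_basic_basic (f g : Fn I M) :
    ∃ h : Fn I M, W.bracket (basic f) (basic g) = basic h := by
  obtain ⟨Q, hQ⟩ := exists_poly_eq_basic f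
  obtain ⟨R, hR⟩ := exists_poly_eq_basic g
  obtain ⟨P, hP⟩ := hW 0 0 Q R
  rw [← hQ, ← hR, hP]
  exact exists_basic_eq_poly P

theorem exists_momentum_basic (X : VField I M) (f : Fn I M) :
    ∃ Z : VField I M, W.bracket (momentum X) (basic f) = momentum Z := by
  obtain ⟨Q, hQ⟩ := exists_poly_eq_momentum X
  obtain ⟨R, hR⟩ := exists_poly_eq_basic f
  obtain ⟨P, hP⟩ := hW 1 0 Q R
  rw [← hQ, ← hR, hP]
  exact exists_momentum_eq_poly P

theorem exists_momentum_momentum (X Y : VField I M) :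
    ∃ G : SymTensor I M 2, W.bracket (momentum X) (momentum Y) = poly G := by
  obtain ⟨Q, hQ⟩ := exists_poly_eq_momentum X
  obtain ⟨R, hR⟩ := exists_poly_eq_momentum Y
  rw [← hQ, ← hR]
  exact hW 1 1 Q R

theorem exists_quadratic_momentum (G : SymTensor I M 2) (X : VField I M) :
    ∃ T : SymTensor I M 3, W.bracket (poly G) (momentum X) = poly T := by
  obtain ⟨R, hR⟩ := exists_poly_eq_momentum X
  rw [← hR]
  exact hW 2 1 G R

/-- A graded bivector field on the cotangent bundle projects to the base. -/
theorem exists_bivector : ∃ w : Bivector I M,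
    ∀ f g, W.bracket (basic f) (basic g) = basic (w.bracket f g) := by
  choose br hbr using hW.exists_basic_basic
  let dπ (x : M) : TangentSpace (cotModel E I) (⟨x, 0⟩ : Cotangent I M) →L[ℝ] TangentSpace I x :=
    mfderiv (cotModel E I) I TotalSpace.proj (⟨x, 0⟩ : Cotangent I M)
  let sharp (x : M) : (TangentSpace I x →L[ℝ] ℝ) →ₗ[ℝ] TangentSpace I x :=
    { toFun := fun α => dπ x (W.sharp ⟨x, 0⟩ (α.comp (dπ x)))
      map_add' := fun α β => (congrArg (dπ x) ((W.sharp ⟨x, 0⟩).map_add (α.comp (dπ x))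
        (β.comp (dπ x)))).trans ((dπ x).map_add _ _)
      map_smul' := fun c α => (congrArg (dπ x) ((W.sharp ⟨x, 0⟩).map_smul c
        (α.comp (dπ x)))).trans ((dπ x).map_smul c _) }
  have skew : ∀ x (α β : TangentSpace I x →L[ℝ] ℝ), β (sharp x α) = -α (sharp x β) :=
    fun x α β => W.skew ⟨x, 0⟩ (α.comp (dπ x)) (β.comp (dπ x))
  have hbr' : ∀ f g : Fn I M, ∀ x, diff g x (sharp x (diff f x)) = br f g x := by
    intro f g x
    have h := congrArg (fun F : Fn (cotModel E I) (Cotangent I M) => F ⟨x, 0⟩) (hbr f g)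
    simp only [W.bracket_apply, diff_basic] at h
    exact h
  refine ⟨⟨sharp, skew, contMDiff_sharp Set.univ
    (fun V hV => contMDiff_of_forall_diff fun f => hV f trivial) skew fun f _ g _ => ?_⟩, ?_⟩
  · simp only [hbr']
    exact (br f g).contMDiff
  · intro f g
    rw [hbr]
    congr 1
    ext x
    exact (hbr' f g x).symm

/-- The data on the base induced by a graded bivector field. -/
theorem exists_induces : ∃ d : BaseData I M, Induces W d := by
  obtain ⟨w, hw⟩ := hW.exists_bivector
  have hdiff : ∀ (α : OneForm I M) (X : VField I M) (ξ : Cotangent I M) (g : Fn I M),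
      diff g ξ.1 = α ξ.1 → connectionFn W α X ξ = W.bracket (basic g) (momentum X) ξ := by
    intro α X ξ g hg
    rw [W.bracket_skew]
    change -(α ξ.1 _) = -(diff (basic g) ξ _)
    rw [diff_basic, hg]
    rfl
  have hlin : ∀ α X, ∃ Z : VField I M, connectionFn W α X = momentum Z := by
    intro α X
    refine exists_momentum_eq _ fun x => ?_
    obtain ⟨g, hg⟩ := exists_diff_eq x (α x)
    obtain ⟨Z, hZ⟩ := hW.exists_momentum_basic X g
    refine ⟨{ toFun := fun ξ => -(ξ (Z x))
              map_add' := fun ξ η => neg_add (ξ (Z x)) (η (Z x))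
              map_smul' := fun c ξ => (mul_neg c (ξ (Z x))).symm }, fun ξ => ?_⟩
    rw [hdiff α X ⟨x, ξ⟩ g hg, W.bracket_skew, hZ]
    rfl
  choose D hD using hlin
  choose Ψ hΨ using hW.exists_momentum_momentum
  choose Θ hΘ using hW.exists_quadratic_momentum
  have hDf : ∀ f X, W.bracket (momentum X) (basic f) = -momentum (D (diff f) X) := by
    intro f X
    rw [W.bracket_skew, ← hD]
    ext ξ
    exact congrArg (fun t : ℝ => -t) (hdiff (diff f) X ξ f rfl).symm
  let D' : ContravariantConnection w :=
    { D := D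
      add_left := fun α β X => by
        apply momentum_injective
        rw [momentum_add, ← hD, ← hD, ← hD]
        ext ξ
        obtain ⟨f, hf⟩ := exists_diff_eq ξ.1 (α ξ.1)
        obtain ⟨g, hg⟩ := exists_diff_eq ξ.1 (β ξ.1)
        rw [ContMDiffMap.coe_add, Pi.add_apply, hdiff _ X ξ _ hf, hdiff _ X ξ _ hg,
          hdiff _ X ξ (f + g) (by rw [diff_add]; exact congrArg₂ (· + ·) hf hg), basic_add,
          W.bracket_add_left]
        rfl
      add_right := fun α X Y => by
        apply momentum_injective
        rw [momentum_add, ← hD, ← hD, ← hD]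
        ext ξ
        obtain ⟨f, hf⟩ := exists_diff_eq ξ.1 (α ξ.1)
        rw [ContMDiffMap.coe_add, Pi.add_apply, hdiff _ X ξ _ hf, hdiff _ Y ξ _ hf,
          hdiff _ _ ξ _ hf, momentum_add, W.bracket_add_right]
        rfl
      smul_left := fun f α X => by
        apply momentum_injective
        rw [momentum_smul, ← hD, ← hD]
        ext ξ
        change -(f ξ.1 * _) = f ξ.1 * -_
        rw [mul_neg]
        rfl
      leibniz := fun α f X => by
        apply momentum_injective
        rw [momentum_add, momentum_smul, momentum_smul, ← hD, ← hD]
        ext ξ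
        obtain ⟨g, hg⟩ := exists_diff_eq ξ.1 (α ξ.1)
        have h1 : fieldDeriv (w.sharpField α) f ξ.1 = w.bracket g f ξ.1 := by
          change diff f ξ.1 (w.sharp ξ.1 (α ξ.1)) = _
          rw [← hg]
          rfl
        simp only [ContMDiffMap.coe_add, ContMDiffMap.coe_mul, Pi.add_apply, Pi.mul_apply,
          basic_apply]
        rw [hdiff _ X ξ _ hg, hdiff _ _ ξ _ hg, momentum_smul, W.bracket_mul_right, hw, h1]
        simp only [ContMDiffMap.coe_add, ContMDiffMap.coe_mul, Pi.add_apply, Pi.mul_apply,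
          basic_apply]
        ring }
  let P : PsiOperator D' :=
    { Ψ := Ψ
      add_right := fun X Y Z => by
        apply poly_injective
        rw [poly_add, ← hΨ, ← hΨ, ← hΨ, momentum_add, W.bracket_add_right]
      skew := fun X Y => by
        apply poly_injective
        rw [poly_neg, ← hΨ, ← hΨ, W.bracket_skew]
      leibniz := fun X f Y => by
        apply poly_injective
        rw [poly_sub, poly_smul, poly_symProd, ← hΨ, ← hΨ, momentum_smul, W.bracket_mul_right, hDf]
        change _ = _ - momentum (D (diff f) X) * _
        ring }
  exact ⟨⟨w, D', P, Θ⟩, hw, fun X f => hDf f X, hΨ, hΘ⟩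

end IsGraded

theorem Bivector.ext_bracket {w w' : Bivector I M} (h : ∀ f g, w.bracket f g = w'.bracket f g) :
    w = w' := by
  ext x α
  obtain ⟨f, rfl⟩ := exists_diff_eq x α
  refine vector_ext fun g => ?_
  exact congrArg (fun k : Fn I M => k x) (h f g)

theorem ContravariantConnection.ext_diff {w : Bivector I M} {D D' : ContravariantConnection w}
    (h : ∀ f X, D.D (diff f) X = D'.D (diff f) X) : D = D' := by
  ext α X x
  obtain ⟨f, hf⟩ := exists_diff_eq x (α x)
  rw [D.apply_congr hf.symm, D'.apply_congr hf.symm, h]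

theorem Induces.unique {d d' : BaseData I M} (h : Induces W d) (h' : Induces W d') : d = d' := by
  obtain ⟨w, D, P, Θ⟩ := d
  obtain ⟨w', D', P', Θ'⟩ := d'
  obtain rfl : w = w' := Bivector.ext_bracket fun f g =>
    basic_injective ((h.basic_basic f g).symm.trans (h'.basic_basic f g))
  obtain rfl : D = D' := ContravariantConnection.ext_diff fun f X =>
    momentum_injective (neg_injective ((h.momentum_basic X f).symm.trans (h'.momentum_basic X f)))
  obtain rfl : P = P' := PsiOperator.ext (funext₂ fun X Y =>
    poly_injective ((h.momentum_momentum X Y).symm.trans (h'.momentum_momentum X Y)))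
  obtain rfl : Θ = Θ' := funext₂ fun G X =>
    poly_injective ((h.quadratic_momentum G X).symm.trans (h'.quadratic_momentum G X))
  rfl

end FromGraded

section FibrePolynomials

variable {E : Type*} [NormedAddCommGroup E] [NormedSpace ℝ E]
  {H : Type*} [TopologicalSpace H]
  {I : ModelWithCorners ℝ E H} {M : Type*} [TopologicalSpace M] [ChartedSpace H M]
  [IsManifold I ∞ M]

/-- The restriction of the function to the fibre over `x` is a homogeneous polynomial. -/
def IsFibrePoly (x : M) (k : ℕ) (G : Fn (cotModel E I) (Cotangent I M)) : Prop :=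
  ∃ μ : MultilinearMap ℝ (fun _ : Fin k => TangentSpace I x →L[ℝ] ℝ) ℝ,
    ∀ ξ, G ⟨x, ξ⟩ = μ fun _ => ξ

namespace IsFibrePoly

variable {x : M} {h k : ℕ} {G G' : Fn (cotModel E I) (Cotangent I M)}

theorem congr_degree (hG : IsFibrePoly x h G) (e : h = k) : IsFibrePoly x k G := e ▸ hG

theorem zero : IsFibrePoly x k (0 : Fn (cotModel E I) (Cotangent I M)) := ⟨0, fun _ => rfl⟩

theorem neg (hG : IsFibrePoly x k G) : IsFibrePoly x k (-G) := by
  obtain ⟨μ, hμ⟩ := hG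
  exact ⟨-μ, fun ξ => congrArg (fun t : ℝ => -t) (hμ ξ)⟩

theorem add (hG : IsFibrePoly x k G) (hG' : IsFibrePoly x k G') : IsFibrePoly x k (G + G') := by
  obtain ⟨μ, hμ⟩ := hG
  obtain ⟨ν, hν⟩ := hG'
  exact ⟨μ + ν, fun ξ => congrArg₂ (· + ·) (hμ ξ) (hν ξ)⟩

theorem mul (hG : IsFibrePoly x h G) (hG' : IsFibrePoly x k G') :
    IsFibrePoly x (h + k) (G * G') := by
  obtain ⟨μ, hμ⟩ := hG
  obtain ⟨ν, hν⟩ := hG'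
  refine ⟨((LinearMap.mul' ℝ ℝ).compMultilinearMap (μ.domCoprod ν)).domDomCongr finSumFinEquiv,
    fun ξ => ?_⟩
  exact congrArg₂ (· * ·) (hμ ξ) (hν ξ)

theorem basic (f : Fn I M) : IsFibrePoly x 0 (GradedPoisson.basic f) :=
  ⟨MultilinearMap.constOfIsEmpty ℝ _ (f x), fun _ => rfl⟩

theorem momentum (X : VField I M) : IsFibrePoly x 1 (GradedPoisson.momentum X) :=
  ⟨MultilinearMap.ofSubsingleton ℝ (TangentSpace I x →L[ℝ] ℝ) ℝ (0 : Fin 1)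
      { toFun := fun ξ => ξ (X x), map_add' := fun _ _ => rfl, map_smul' := fun _ _ => rfl },
    fun _ => rfl⟩

theorem poly [FiniteDimensional ℝ E] [T2Space M] (Q : SymTensor I M k) :
    IsFibrePoly x k (GradedPoisson.poly Q) := ⟨Q.form x, fun _ => rfl⟩

end IsFibrePoly

/-- Sums of products of functions of the base with `k` momenta. -/
inductive IsMonomialSum : ℕ → Fn (cotModel E I) (Cotangent I M) → Prop
  | basic (f : Fn I M) : IsMonomialSum 0 (GradedPoisson.basic f)
  | mul_momentum {k G} (hG : IsMonomialSum k G) (X : VField I M) :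
      IsMonomialSum (k + 1) (G * GradedPoisson.momentum X)
  | zero (k) : IsMonomialSum k 0
  | add {k G G'} (hG : IsMonomialSum k G) (hG' : IsMonomialSum k G') : IsMonomialSum k (G + G')

namespace IsMonomialSum

variable {k : ℕ} {G : Fn (cotModel E I) (Cotangent I M)}

theorem isFibrePoly (hG : IsMonomialSum k G) (x : M) : IsFibrePoly x k G := by
  induction hG with
  | basic f => exact IsFibrePoly.basic f
  | mul_momentum _ X ih => exact ih.mul (IsFibrePoly.momentum X)
  | zero k => exact IsFibrePoly.zero
  | add _ _ ih ih' => exact ih.add ih'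

theorem basic_mul_prod (f : Fn I M) (X : Fin k → VField I M) :
    IsMonomialSum k (GradedPoisson.basic f * ∏ j, momentum (X j)) := by
  induction k with
  | zero => simpa using IsMonomialSum.basic f
  | succ k ih =>
    rw [Fin.prod_univ_castSucc, ← mul_assoc]
    exact (ih fun j => X j.castSucc).mul_momentum _

theorem sum {ι : Type*} (s : Finset ι) (G : ι → Fn (cotModel E I) (Cotangent I M))
    (h : ∀ i ∈ s, IsMonomialSum k (G i)) : IsMonomialSum k (∑ i ∈ s, G i) :=
  Finset.sum_induction G (IsMonomialSum k) (fun _ _ => add) (zero k) h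

variable {W : Bivector (cotModel E I) (Cotangent I M)}

theorem isFibrePoly_bracket_left (hG : IsMonomialSum k G) {x : M} {j : ℕ}
    {F : Fn (cotModel E I) (Cotangent I M)}
    (hb : ∀ f : Fn I M, IsFibrePoly x j (W.bracket F (GradedPoisson.basic f)))
    (hm : ∀ X : VField I M, IsFibrePoly x (j + 1) (W.bracket F (momentum X))) :
    IsFibrePoly x (j + k) (W.bracket F G) := by
  induction hG with
  | basic f => exact hb f
  | @mul_momentum k G hG X ih =>
    rw [W.bracket_mul_right]
    exact (((hG.isFibrePoly x).mul (hm X)).congr_degree (by omega)).add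
      (((IsFibrePoly.momentum X).mul ih).congr_degree (by omega))
  | zero k =>
    have : W.bracket F 0 = 0 := by
      have h := W.bracket_add_right F 0 0
      rwa [add_zero, left_eq_add] at h
    rw [this]
    exact IsFibrePoly.zero
  | add _ _ ih ih' =>
    rw [W.bracket_add_right]
    exact ih.add ih'

end IsMonomialSum

variable [FiniteDimensional ℝ E] [T2Space M]

/-- Near every fibre a homogeneous polynomial function is a sum of monomials. -/
theorem exists_isMonomialSum {k : ℕ} (Q : SymTensor I M k) (x : M) :
    ∃ G, IsMonomialSum k G ∧ ∀ ξ, diff (poly Q) ⟨x, ξ⟩ = diff G ⟨x, ξ⟩ := by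
  obtain ⟨f, X, h⟩ := coord_covector_eq (I := I) x
  refine ⟨∑ r : Fin k → Fin (Module.finrank ℝ E),
    basic (Q.eval fun j => diff (f (r j))) * ∏ j, momentum (X (r j)),
    IsMonomialSum.sum _ _ fun r _ => IsMonomialSum.basic_mul_prod _ _, fun ξ => ?_⟩
  refine diff_apply_congr ?_
  have hc : Filter.Tendsto (fun ξ : Cotangent I M => ξ.1) (𝓝 ⟨x, ξ⟩) (𝓝 x) :=
    (FiberBundle.continuous_proj (E →L[ℝ] ℝ)
      (fun x : M => TangentSpace I x →L[ℝ] ℝ)).continuousAt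
  filter_upwards [hc.eventually h] with η hη
  have e1 : ∀ (F : (Fin k → Fin (Module.finrank ℝ E)) → Fn (cotModel E I) (Cotangent I M)),
      (∑ r, F r) η = ∑ r, F r η := fun F =>
    map_sum (ContMDiffMap.evalRingHom (n := ∞) (I := cotModel E I) (R := ℝ) η) F Finset.univ
  have e2 : ∀ (F : Fin k → Fn (cotModel E I) (Cotangent I M)),
      (∏ j, F j) η = ∏ j, F j η := fun F =>
    map_prod (ContMDiffMap.evalRingHom (n := ∞) (I := cotModel E I) (R := ℝ) η) F Finset.univ
  rw [e1, poly_apply]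
  conv_lhs => rw [hη η.2]
  rw [MultilinearMap.map_sum]
  refine Finset.sum_congr rfl fun r _ => ?_
  rw [MultilinearMap.map_smul_univ, ContMDiffMap.coe_mul, Pi.mul_apply, e2, mul_comm]
  rfl

/-- A bivector field on the cotangent bundle is graded if its bracket has the right degree on
functions of the base and momenta. -/
theorem isGraded_of_generators {W : Bivector (cotModel E I) (Cotangent I M)}
    (hbb : ∀ x f g, IsFibrePoly x 0 (W.bracket (basic f) (basic g)))
    (hmb : ∀ x X f, IsFibrePoly x 1 (W.bracket (momentum X) (basic f)))
    (hmm : ∀ x X Y, IsFibrePoly x 2 (W.bracket (momentum X) (momentum Y))) : IsGraded W := by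
  intro h k Q R
  refine exists_poly_eq _ fun x => ?_
  obtain ⟨G, hG, eG⟩ := exists_isMonomialSum Q x
  obtain ⟨G', hG', eG'⟩ := exists_isMonomialSum R x
  have hb : ∀ f, IsFibrePoly x h (W.bracket G (basic f)) := fun f => by
    rw [W.bracket_skew]
    refine ((hG.isFibrePoly_bracket_left (j := 0) (hbb x f) fun X => ?_).congr_degree
      (by omega)).neg
    rw [W.bracket_skew]
    exact (hmb x X f).neg
  have hm : ∀ X, IsFibrePoly x (h + 1) (W.bracket G (momentum X)) := fun X => by
    rw [W.bracket_skew]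
    exact ((hG.isFibrePoly_bracket_left (j := 1) (hmb x X) (hmm x X)).congr_degree
      (by omega)).neg
  obtain ⟨μ, hμ⟩ := hG'.isFibrePoly_bracket_left hb hm
  exact ⟨μ, fun ξ => (W.bracket_apply_congr (eG ξ) (eG' ξ)).trans (hμ ξ)⟩

end FibrePolynomials

/-- A skew-symmetric form on `P` that vanishes on the kernel of a surjection of `P` to the dual
of `V` comes from a skew-symmetric map from the dual of `V` to `V`. -/
theorem exists_sharp {V P : Type*} [NormedAddCommGroup V] [NormedSpace ℝ V]
    [FiniteDimensional ℝ V] [AddCommGroup P] [Module ℝ P] (S : P →ₗ[ℝ] (V →L[ℝ] ℝ))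
    (hS : Function.Surjective S) (B : P →ₗ[ℝ] P →ₗ[ℝ] ℝ) (hskew : ∀ p q, B p q = -B q p)
    (hB : ∀ p, S p = 0 → ∀ q, B p q = 0) :
    ∃ s : (V →L[ℝ] ℝ) →ₗ[ℝ] V, ∀ p q, S q (s (S p)) = B p q := by
  obtain ⟨R, hR⟩ := S.exists_rightInverse_of_surjective (LinearMap.range_eq_top.2 hS)
  have hR' : ∀ a, S (R a) = a := LinearMap.congr_fun hR
  let e : V ≃ₗ[ℝ] Module.Dual ℝ (V →L[ℝ] ℝ) := (Module.evalEquiv ℝ V).trans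
    (LinearMap.toContinuousLinearMap (𝕜 := ℝ) (E := V) (F' := ℝ)).symm.dualMap
  have he : ∀ (φ : Module.Dual ℝ (V →L[ℝ] ℝ)) (b : V →L[ℝ] ℝ), b (e.symm φ) = φ b := by
    intro φ b
    conv_rhs => rw [← e.apply_symm_apply φ]
    rfl
  refine ⟨e.symm.toLinearMap ∘ₗ (B.compl₁₂ R R), fun p q => ?_⟩
  change S q (e.symm (B.compl₁₂ R R (S p))) = _
  rw [he]
  change B (R (S p)) (R (S q)) = B p q
  have key : ∀ p q, B (R (S p)) q = B p q := fun p q => by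
    rw [← sub_eq_zero, ← LinearMap.sub_apply, ← map_sub]
    exact hB _ (by rw [map_sub, hR', sub_self]) q
  rw [key, hskew, key, ← hskew]

section ToGraded

variable {E : Type*} [NormedAddCommGroup E] [NormedSpace ℝ E] [FiniteDimensional ℝ E]
  {H : Type*} [TopologicalSpace H]
  {I : ModelWithCorners ℝ E H} {M : Type*} [TopologicalSpace M] [ChartedSpace H M] [T2Space M]
  [IsManifold I ∞ M] {w : Bivector I M} (D : ContravariantConnection w) (P : PsiOperator D)

theorem constFn_smul (c : ℝ) (X : VField I M) : (constFn c : Fn I M) • X = c • X := rfl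

theorem ContravariantConnection.zero_left (X : VField I M) : D.D 0 X = 0 :=
  map_zero (AddMonoidHom.mk' (fun α => D.D α X) fun α β => D.add_left α β X)

theorem fieldDeriv_constFn (X : VField I M) (c : ℝ) : fieldDeriv X (constFn c : Fn I M) = 0 := by
  rw [fieldDeriv, diff_const]
  rfl

theorem symProd_diag (X Y : VField I M) (x : M) (ξ : TangentSpace I x →L[ℝ] ℝ) :
    (symProd X Y).form x (fun _ => ξ) = ξ (X x) * ξ (Y x) := by
  change (1 / 2) * (ξ (X x) * ξ (Y x) + ξ (Y x) * ξ (X x)) = ξ (X x) * ξ (Y x)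
  ring

/-- `X ↦ ⟨ξ, D_α X⟩` at a point. -/
def connectionAt (α : OneForm I M) {x : M} (ξ : TangentSpace I x →L[ℝ] ℝ) : VField I M →ₗ[ℝ] ℝ where
  toFun X := ξ (D.D α X x)
  map_add' X Y := by rw [D.add_right]; exact map_add ξ _ _
  map_smul' c X := by
    rw [← constFn_smul, D.leibniz, fieldDeriv_constFn]
    simp

/-- `f ↦ ⟨ξ, D_{df} X⟩` at a point. -/
def connectionAtFn (X : VField I M) {x : M} (ξ : TangentSpace I x →L[ℝ] ℝ) : Fn I M →ₗ[ℝ] ℝ where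
  toFun f := ξ (D.D (diff f) X x)
  map_add' f g := by rw [diff_add, D.add_left]; exact map_add ξ _ _
  map_smul' c f := by
    have h : diff (c • f) x = ((constFn c : Fn I M) • diff f) x := diff_const_smul c f x
    rw [D.apply_congr h, D.smul_left]
    simp

/-- `Y ↦ Ψ(X, Y)(ξ, ξ)` at a point. -/
def psiAt (X : VField I M) {x : M} (ξ : TangentSpace I x →L[ℝ] ℝ) : VField I M →ₗ[ℝ] ℝ where
  toFun Y := (P.Ψ X Y).form x fun _ => ξ
  map_add' Y Z := by rw [P.add_right]; rfl
  map_smul' c Y := by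
    rw [← constFn_smul, P.leibniz, diff_const, D.zero_left]
    change c * (P.Ψ X Y).form x (fun _ => ξ) - (symProd 0 Y).form x (fun _ => ξ) = _
    rw [symProd_diag]
    simp

theorem connectionAt_smul (α : OneForm I M) {x : M} (ξ : TangentSpace I x →L[ℝ] ℝ) (f : Fn I M)
    (X : VField I M) : connectionAt D α ξ (f • X) =
      f x * connectionAt D α ξ X + fieldDeriv (w.sharpField α) f x * ξ (X x) := by
  change ξ (D.D α (f • X) x) = _
  rw [D.leibniz]
  simp [connectionAt]

theorem psiAt_smul (X : VField I M) {x : M} (ξ : TangentSpace I x →L[ℝ] ℝ) (f : Fn I M)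
    (Y : VField I M) : psiAt D P X ξ (f • Y) =
      f x * psiAt D P X ξ Y - connectionAtFn D X ξ f * ξ (Y x) := by
  change (P.Ψ X (f • Y)).form x (fun _ => ξ) = _
  rw [P.leibniz]
  change f x * _ - (symProd (D.D (diff f) X) Y).form x (fun _ => ξ) = _
  rw [symProd_diag]
  rfl

theorem psiAt_skew (X Y : VField I M) {x : M} (ξ : TangentSpace I x →L[ℝ] ℝ) :
    psiAt D P X ξ Y = -psiAt D P Y ξ X := by
  change (P.Ψ X Y).form x _ = -(P.Ψ Y X).form x _
  rw [P.skew Y X]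
  rfl

/-- `f ↦ {g, f}` at a point. -/
def bracketAt (w : Bivector I M) (g : Fn I M) (x : M) : Fn I M →ₗ[ℝ] ℝ where
  toFun f := w.bracket g f x
  map_add' f h := by rw [w.bracket_add_right]; rfl
  map_smul' c f := by
    rw [w.bracket_apply, diff_const_smul]
    rfl

/-- The value at `ξ` of the bracket of `f + m(X)` and `g + m(Y)`. -/
def bracketForm (ξ : Cotangent I M) :
    (Fn I M × VField I M) →ₗ[ℝ] (Fn I M × VField I M) →ₗ[ℝ] ℝ :=
  have hs : ∀ p q : Fn I M × VField I M,
      bracketAt w p.1 ξ.1 q.1 + connectionAt D (diff p.1) ξ.2 q.2 - connectionAtFn D p.2 ξ.2 q.1 +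
        psiAt D P p.2 ξ.2 q.2 =
      -(bracketAt w q.1 ξ.1 p.1 + connectionAt D (diff q.1) ξ.2 p.2 -
        connectionAtFn D q.2 ξ.2 p.1 + psiAt D P q.2 ξ.2 p.2) := fun p q => by
    have h1 : bracketAt w p.1 ξ.1 q.1 = -bracketAt w q.1 ξ.1 p.1 :=
      congrArg (fun f : Fn I M => f ξ.1) (w.bracket_skew p.1 q.1)
    have h2 : ∀ p q : Fn I M × VField I M, connectionAt D (diff p.1) ξ.2 q.2 =
      connectionAtFn D q.2 ξ.2 p.1 := fun _ _ => rfl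
    rw [h1, psiAt_skew, h2 p q, h2 q p]
    ring
  have ha : ∀ p q r : Fn I M × VField I M,
      bracketAt w p.1 ξ.1 (q + r).1 + connectionAt D (diff p.1) ξ.2 (q + r).2 -
        connectionAtFn D p.2 ξ.2 (q + r).1 + psiAt D P p.2 ξ.2 (q + r).2 =
      (bracketAt w p.1 ξ.1 q.1 + connectionAt D (diff p.1) ξ.2 q.2 -
        connectionAtFn D p.2 ξ.2 q.1 + psiAt D P p.2 ξ.2 q.2) +
      (bracketAt w p.1 ξ.1 r.1 + connectionAt D (diff p.1) ξ.2 r.2 -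
        connectionAtFn D p.2 ξ.2 r.1 + psiAt D P p.2 ξ.2 r.2) := fun p q r => by
    simp only [Prod.fst_add, Prod.snd_add, map_add]
    ring
  have hc : ∀ (c : ℝ) (p q : Fn I M × VField I M),
      bracketAt w p.1 ξ.1 (c • q).1 + connectionAt D (diff p.1) ξ.2 (c • q).2 -
        connectionAtFn D p.2 ξ.2 (c • q).1 + psiAt D P p.2 ξ.2 (c • q).2 =
      c • (bracketAt w p.1 ξ.1 q.1 + connectionAt D (diff p.1) ξ.2 q.2 -
        connectionAtFn D p.2 ξ.2 q.1 + psiAt D P p.2 ξ.2 q.2) := fun c p q => by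
    simp only [Prod.smul_fst, Prod.smul_snd, map_smul, smul_eq_mul]
    ring
  LinearMap.mk₂ ℝ (fun p q => bracketAt w p.1 ξ.1 q.1 + connectionAt D (diff p.1) ξ.2 q.2 -
      connectionAtFn D p.2 ξ.2 q.1 + psiAt D P p.2 ξ.2 q.2)
    (fun p q r => by rw [hs, ha, hs p r, hs q r]; ring)
    (fun c p q => by rw [hs, hc, hs p q, smul_neg])
    (fun p q r => ha p q r) (fun c p q => hc c p q)

theorem bracketForm_apply (ξ : Cotangent I M) (p q : Fn I M × VField I M) :
    bracketForm D P ξ p q = w.bracket p.1 q.1 ξ.1 + ξ.2 (D.D (diff p.1) q.2 ξ.1) -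
      ξ.2 (D.D (diff q.1) p.2 ξ.1) + (P.Ψ p.2 q.2).form ξ.1 fun _ => ξ.2 := rfl

theorem bracketForm_skew (ξ : Cotangent I M) (p q : Fn I M × VField I M) :
    bracketForm D P ξ p q = -bracketForm D P ξ q p := by
  rw [bracketForm_apply, bracketForm_apply, w.bracket_skew p.1, P.skew q.2]
  change -w.bracket q.1 p.1 ξ.1 + _ - _ + -((P.Ψ q.2 p.2).form ξ.1 fun _ => ξ.2) = _
  ring

/-- The differential of `f + m(X)`. -/
def generatorDiff (ξ : Cotangent I M) :
    (Fn I M × VField I M) →ₗ[ℝ] (TangentSpace (cotModel E I) ξ →L[ℝ] ℝ) :=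
  diffAt (cotModel E I) ξ ∘ₗ (basicHom I M).coprod (momentumHom I M)

theorem generatorDiff_apply (ξ : Cotangent I M) (p : Fn I M × VField I M) :
    generatorDiff ξ p = diff (basic p.1 + momentum p.2) ξ := rfl

theorem diff_eq_zero_of_basic {f : Fn I M} {ξ : Cotangent I M} (h : diff (basic f) ξ = 0) :
    diff f ξ.1 = 0 := by
  obtain ⟨β, hβ⟩ := exists_section_eq (I := I) (F := E →L[ℝ] ℝ)
    (V := fun x : M => TangentSpace I x →L[ℝ] ℝ) ξ.1 ξ.2
  have h1 := diff_comp (basic f) (OneForm.toMap β) ξ.1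
  have h2 : OneForm.toMap β ξ.1 = ξ := by
    change (⟨ξ.1, β ξ.1⟩ : Cotangent I M) = ξ
    rw [hβ]
  rw [h2, h] at h1
  refine Eq.trans ?_ (h1.trans (ContinuousLinearMap.zero_comp _))
  rfl

theorem eq_zero_of_generatorDiff {ξ : Cotangent I M} {p : Fn I M × VField I M}
    (h : generatorDiff ξ p = 0) : p.2 ξ.1 = 0 := by
  obtain ⟨x, ξ⟩ := ξ
  refine vector_ext fun g => ?_
  obtain ⟨u, hu⟩ := exists_vertical ξ (diff g x)
  have h1 : HasDerivAt (fun t : ℝ => (p.1 x + ξ (p.2 x)) + t * diff g x (p.2 x))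
      (1 * diff g x (p.2 x)) 0 := ((hasDerivAt_id (0 : ℝ)).mul_const _).const_add _
  have h2 : (fun t : ℝ => (basic p.1 + momentum p.2) (⟨x, ξ + t • diff g x⟩ : Cotangent I M)) =
      fun t : ℝ => (p.1 x + ξ (p.2 x)) + t * diff g x (p.2 x) := by
    funext t
    exact (add_assoc (p.1 x) (ξ (p.2 x)) (t * diff g x (p.2 x))).symm
  have h3 := hu (basic p.1 + momentum p.2)
  rw [h2, h1.deriv, ← generatorDiff_apply, h] at h3
  change diff g x (p.2 x) = diff g x 0
  rw [map_zero, ← one_mul (diff g x (p.2 x)), ← h3]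
  rfl

theorem bracketForm_eq_zero (ξ : Cotangent I M) (p : Fn I M × VField I M)
    (h : generatorDiff ξ p = 0) (q : Fn I M × VField I M) : bracketForm D P ξ p q = 0 := by
  have hX := eq_zero_of_generatorDiff h
  obtain ⟨f, X⟩ := p
  obtain ⟨g, Y⟩ := q
  obtain ⟨x, ξ⟩ := ξ
  change X x = 0 at hX
  obtain ⟨ψ, s, hψ, -, hd⟩ := exists_decomp (I := I) (V := (TangentSpace I : M → Type _))
    (Module.finBasis ℝ E) x
  obtain ⟨C, hC, hsum⟩ := hd X
  have hψ1 : (ψ * ψ) x = 1 := by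
    rw [ContMDiffMap.coe_mul, Pi.mul_apply, hψ.self_of_nhds]
    simp
  have hC0 : ∀ i, C i x = 0 := by
    intro i
    have h0 : (trivializationAt E (TangentSpace I : M → Type _) x ⟨x, X x⟩).2 = 0 := by
      rw [hX]
      have := congrFun (Trivialization.coe_linearMapAt_of_mem (R := ℝ)
        (trivializationAt E (TangentSpace I : M → Type _) x)
        (FiberBundle.mem_baseSet_trivializationAt E (TangentSpace I : M → Type _) x)) 0
      rw [← this, map_zero]
    rw [hC, h0]
    simp
  set φ : Fn I M := f + ∑ i, ξ (s i x) • C i with hφ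
  have hm : diff (momentum X) (⟨x, ξ⟩ : Cotangent I M) =
      ∑ i, ξ (s i x) • diff (basic (C i)) (⟨x, ξ⟩ : Cotangent I M) := by
    have e1 : diff (momentum ((ψ * ψ) • X)) (⟨x, ξ⟩ : Cotangent I M) =
        diff (momentum X) (⟨x, ξ⟩ : Cotangent I M) := by
      rw [momentum_smul, diff_mul]
      change (ψ * ψ) x • diff (momentum X) (⟨x, ξ⟩ : Cotangent I M) +
      ξ (X x) • diff (basic (ψ * ψ)) (⟨x, ξ⟩ : Cotangent I M) = _
      rw [hψ1, hX, map_zero, zero_smul, one_smul, add_zero]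
    rw [← e1, hsum, ← momentumHom_apply, ← diffAt_apply, map_sum, map_sum]
    refine Finset.sum_congr rfl fun i _ => ?_
    rw [diffAt_apply, momentumHom_apply, momentum_smul, diff_mul]
    change C i x • diff (momentum (s i)) (⟨x, ξ⟩ : Cotangent I M) +
      ξ (s i x) • diff (basic (C i)) (⟨x, ξ⟩ : Cotangent I M) = _
    rw [hC0, zero_smul, zero_add]
  have hφ0 : diff φ x = 0 := by
    refine diff_eq_zero_of_basic (ξ := (⟨x, ξ⟩ : Cotangent I M)) ?_
    rw [← basicHom_apply, ← diffAt_apply, hφ, map_add, map_sum, map_add, map_sum]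
    simp only [map_smul, basicHom_apply, diffAt_apply]
    rw [← hm, ← h, generatorDiff_apply, diff_add]
    rfl
  have hcon : connectionAt D (diff g) ξ X = ∑ i, ξ (s i x) * w.bracket g (C i) x := by
    have e1 : connectionAt D (diff g) ξ ((ψ * ψ) • X) = connectionAt D (diff g) ξ X := by
      rw [connectionAt_smul, hψ1, hX, map_zero, mul_zero, one_mul, add_zero]
    rw [← e1, hsum, map_sum]
    refine Finset.sum_congr rfl fun i _ => ?_
    rw [connectionAt_smul, hC0, zero_mul, zero_add, mul_comm]
    rfl
  have hpsi : psiAt D P Y ξ X = -∑ i, ξ (s i x) * connectionAtFn D Y ξ (C i) := by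
    have e1 : psiAt D P Y ξ ((ψ * ψ) • X) = psiAt D P Y ξ X := by
      rw [psiAt_smul, hψ1, hX, map_zero, mul_zero, one_mul, sub_zero]
    rw [← e1, hsum, map_sum, ← Finset.sum_neg_distrib]
    refine Finset.sum_congr rfl fun i _ => ?_
    rw [psiAt_smul, hC0, zero_mul, zero_sub, mul_comm]
  have hb0 : bracketAt w g x φ = 0 := by
    change diff φ x _ = 0
    rw [hφ0]
    rfl
  have hc0 : connectionAtFn D Y ξ φ = 0 := by
    change ξ (D.D (diff φ) Y x) = 0
    rw [D.apply_congr (β := 0) hφ0, D.zero_left]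
    exact map_zero ξ
  rw [hφ, map_add, map_sum] at hb0 hc0
  simp only [map_smul, smul_eq_mul] at hb0 hc0
  rw [bracketForm_skew]
  change -(bracketAt w g x f + connectionAt D (diff g) ξ X - connectionAtFn D Y ξ f +
    psiAt D P Y ξ X) = 0
  rw [hcon, hpsi]
  change bracketAt w g x f + ∑ i, ξ (s i x) * w.bracket g (C i) x = 0 at hb0
  linarith

/-- The bivector field on the cotangent bundle defined by base data. -/
theorem exists_cotangent_bivector : ∃ W : Bivector (cotModel E I) (Cotangent I M),
    ∀ (p q : Fn I M × VField I M) (ξ : Cotangent I M),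
      W.bracket (basic p.1 + momentum p.2) (basic q.1 + momentum q.2) ξ =
        bracketForm D P ξ p q := by
  have hsurj : ∀ ξ : Cotangent I M, Function.Surjective (generatorDiff (I := I) ξ) := fun ξ a => by
    obtain ⟨f, X, h⟩ := exists_basic_add_momentum_eq ξ a
    exact ⟨(f, X), h⟩
  have hex : ∀ ξ : Cotangent I M, ∃ s : (TangentSpace (cotModel E I) ξ →L[ℝ] ℝ) →ₗ[ℝ]
      TangentSpace (cotModel E I) ξ, ∀ p q : Fn I M × VField I M,
        generatorDiff ξ q (s (generatorDiff ξ p)) = bracketForm D P ξ p q := fun ξ =>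
    exists_sharp (V := E × (E →L[ℝ] ℝ)) (generatorDiff ξ) (hsurj ξ) (bracketForm D P ξ)
      (bracketForm_skew D P ξ) (bracketForm_eq_zero D P ξ)
  choose s hs using hex
  have skew : ∀ ξ (a b : TangentSpace (cotModel E I) ξ →L[ℝ] ℝ), b (s ξ a) = -a (s ξ b) := by
    intro ξ a b
    obtain ⟨p, rfl⟩ := hsurj ξ a
    obtain ⟨q, rfl⟩ := hsurj ξ b
    rw [hs, hs, bracketForm_skew]
  refine ⟨⟨s, skew, contMDiff_sharp {F | ∃ p : Fn I M × VField I M,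
    F = basic p.1 + momentum p.2} (fun V hV => ?_) skew ?_⟩, fun p q ξ => hs ξ p q⟩
  · refine contMDiff_of_basic_momentum (fun f => ?_) fun X => ?_
    · refine hV _ ⟨(f, 0), ?_⟩
      rw [← momentumHom_apply, map_zero, add_zero]
    · refine hV _ ⟨(0, X), ?_⟩
      rw [← basicHom_apply, map_zero, zero_add]
  · rintro _ ⟨p, rfl⟩ _ ⟨q, rfl⟩
    let F : Fn (cotModel E I) (Cotangent I M) := basic (w.bracket p.1 q.1) +
      momentum (D.D (diff p.1) q.2) - momentum (D.D (diff q.1) p.2) + poly (P.Ψ p.2 q.2)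
    have h : (fun ξ => diff (basic q.1 + momentum q.2) ξ
        (s ξ (diff (basic p.1 + momentum p.2) ξ))) = fun ξ => F ξ := by
      funext ξ
      exact hs ξ p q
    rw [h]
    exact F.contMDiff

theorem Induces.bivector_unique {W W' : Bivector (cotModel E I) (Cotangent I M)}
    {Θ Θ' : SymTensor I M 2 → VField I M → SymTensor I M 3}
    (h : Induces W ⟨w, D, P, Θ⟩) (h' : Induces W' ⟨w, D, P, Θ'⟩) : W' = W := by
  ext ξ a
  obtain ⟨f, X, rfl⟩ := exists_basic_add_momentum_eq ξ a
  refine tangent_ext (fun g => ?_) fun Y => ?_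
  · rw [← W.bracket_apply, ← W'.bracket_apply, W.bracket_add_left, W'.bracket_add_left,
      h.basic_basic, h'.basic_basic, h.momentum_basic, h'.momentum_basic]
  · rw [← W.bracket_apply, ← W'.bracket_apply, W.bracket_add_left, W'.bracket_add_left,
      h.basic_momentum, h'.basic_momentum, h.momentum_momentum, h'.momentum_momentum]

/-- Base data define a graded bivector field on the cotangent bundle. -/
theorem exists_isGraded_induces : ∃ (W : Bivector (cotModel E I) (Cotangent I M))
    (Θ : SymTensor I M 2 → VField I M → SymTensor I M 3),
    Induces W ⟨w, D, P, Θ⟩ ∧ IsGraded W := by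
  obtain ⟨W, hW⟩ := exists_cotangent_bivector D P
  have m0 : momentum (0 : VField I M) = 0 := map_zero (momentumHom I M)
  have b0 : basic (0 : Fn I M) = 0 := rfl
  have d0 : diff (0 : Fn I M) = 0 := diff_const 0
  have hbb : ∀ f g, W.bracket (basic f) (basic g) = basic (w.bracket f g) := by
    intro f g
    ext ξ
    have h := hW (f, 0) (g, 0) ξ
    simp only [m0, add_zero] at h
    rw [h]
    change _ + connectionAt D (diff f) ξ.2 0 - connectionAt D (diff g) ξ.2 0 +
      psiAt D P 0 ξ.2 0 = _
    rw [map_zero, map_zero, map_zero, add_zero, sub_zero, add_zero]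
    rfl
  have hmb : ∀ X f, W.bracket (momentum X) (basic f) = -momentum (D.D (diff f) X) := by
    intro X f
    ext ξ
    have h := hW (0, X) (f, 0) ξ
    simp only [m0, b0, add_zero, zero_add] at h
    rw [h]
    change bracketAt w 0 ξ.1 f + connectionAt D (diff 0) ξ.2 0 - connectionAt D (diff f) ξ.2 X +
      psiAt D P X ξ.2 0 = -connectionAt D (diff f) ξ.2 X
    have h1 : bracketAt w 0 ξ.1 f = 0 := by
      change diff f ξ.1 (w.sharp ξ.1 (diff 0 ξ.1)) = 0
      rw [d0]
      exact (congrArg _ (map_zero (w.sharp ξ.1))).trans (map_zero (diff f ξ.1))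
    rw [map_zero, map_zero, h1]
    ring
  have hmm : ∀ X Y, W.bracket (momentum X) (momentum Y) = poly (P.Ψ X Y) := by
    intro X Y
    ext ξ
    have h := hW (0, X) (0, Y) ξ
    simp only [b0, zero_add] at h
    rw [h]
    change bracketAt w 0 ξ.1 0 + connectionAtFn D Y ξ.2 0 - connectionAtFn D X ξ.2 0 +
      psiAt D P X ξ.2 Y = psiAt D P X ξ.2 Y
    rw [map_zero, map_zero, map_zero]
    ring
  have hgr : IsGraded W := by
    refine isGraded_of_generators (fun x f g => ?_) (fun x X f => ?_) fun x X Y => ?_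
    · rw [hbb]
      exact IsFibrePoly.basic _
    · rw [hmb]
      exact (IsFibrePoly.momentum _).neg
    · rw [hmm]
      exact IsFibrePoly.poly _
  choose Θ hΘ using hgr.exists_quadratic_momentum
  exact ⟨W, Θ, ⟨hbb, hmb, hmm, hΘ⟩, hgr⟩

end ToGraded

end GradedPoisson

end

theorem proposition1p7 (n : ℕ) (M : Type*) [TopologicalSpace M]
    [ChartedSpace (EuclideanSpace ℝ (Fin n)) M] [IsManifold (𝓡 n) ∞ M]
    [T2Space M] [SecondCountableTopology M] :
    -- every graded Poisson structure on the cotangent bundle determines unique base data,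
    -- and these satisfy the four conditions
    (∀ W : GradedPoisson.Bivector
        (GradedPoisson.cotModel (EuclideanSpace ℝ (Fin n)) (𝓡 n)) (GradedPoisson.Cotangent (𝓡 n) M),
      W.IsPoisson → GradedPoisson.IsGraded W →
        ∃ d : GradedPoisson.BaseData (𝓡 n) M, GradedPoisson.Induces W d ∧ d.IsIntegrable ∧
          ∀ d' : GradedPoisson.BaseData (𝓡 n) M, GradedPoisson.Induces W d' → d' = d) ∧
    -- conversely, `w`, `D`, `Ψ` determine a unique bivector field `W` and a unique `Θ`; this `W` is
    -- graded, and it is a Poisson structure exactly when the four conditions hold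
    (∀ (w : GradedPoisson.Bivector (𝓡 n) M) (D : GradedPoisson.ContravariantConnection w)
      (P : GradedPoisson.PsiOperator D),
      ∃ (W : GradedPoisson.Bivector
          (GradedPoisson.cotModel (EuclideanSpace ℝ (Fin n)) (𝓡 n))
          (GradedPoisson.Cotangent (𝓡 n) M))
        (Θ : GradedPoisson.SymTensor (𝓡 n) M 2 → GradedPoisson.VField (𝓡 n) M →
          GradedPoisson.SymTensor (𝓡 n) M 3),
        GradedPoisson.Induces W ⟨w, D, P, Θ⟩ ∧ GradedPoisson.IsGraded W ∧
        (W.IsPoisson ↔ (⟨w, D, P, Θ⟩ : GradedPoisson.BaseData (𝓡 n) M).IsIntegrable) ∧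
        ∀ W' Θ', GradedPoisson.Induces W' ⟨w, D, P, Θ'⟩ → W' = W ∧ Θ' = Θ) := by
  refine ⟨fun W hW hgr => ?_, fun w D P => ?_⟩
  · obtain ⟨d, hd⟩ := hgr.exists_induces
    exact ⟨d, hd, hd.isIntegrable hW, fun d' hd' => hd'.unique hd⟩
  · obtain ⟨W, Θ, h, hgr⟩ := GradedPoisson.exists_isGraded_induces D P
    refine ⟨W, Θ, h, hgr, ⟨h.isIntegrable, h.isPoisson⟩, fun W' Θ' h' => ?_⟩
    obtain rfl := GradedPoisson.Induces.bivector_unique D P h h'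
    exact ⟨rfl, congrArg GradedPoisson.BaseData.Θ (h'.unique h)⟩
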